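/- Let $k$ be a field of characteristic zero, and suppose that for some integer $\ell\ge2$ the field $k$ contains all $\ell$-primary roots of unity, i.e. all roots of unity of order $\ell^m$ for all $m\ge0$. Let $n,N\ge0$ be integers and $L=k(x_1,\dots,x_n)$. Let $\mathbb Z_{\neq0}\ltimes k^\times$ be the semigroup of pairs $(q,c)$ with $q\in\mathbb Z\setminus\{0\}$, $c\in k^\times$ and product $(q,c)(q',c')=(qq',c^{q'}c')$, i.e. the semigroup of the $k$-endomorphisms $x\mapsto c\,x^q$ of $k(x)$ under composition, and let $H=(\mathbb Z_{\neq0}\ltimes k^\times)^n$ act on $L$ by the $k$-endomorphisms $x_j\mapsto c_jx_j^{q_j}$ and trivially on $k$. For a field $F$ with an action of $H$ by field endomorphisms, let $H^1(H,\mathrm{GL}_NF)$ be the set of families $(f_\sigma)_{\sigma\in H}$ in $\mathrm{GL}_NF$ with $f_{\sigma\tau}=f_\sigma\cdot\sigma(f_\tau)$, modulo the relation $(f_\sigma)\sim(b^{-1}f_\sigma\,\sigma(b))$ for $b\in\mathrm{GL}_NF$. Then the natural map $$H^1(H,\mathrm{GL}_Nk)\longrightarrow H^1(H,\mathrm{GL}_NL)$$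 induced by the inclusion $\mathrm{GL}_Nk\subset\mathrm{GL}_NL$ is bijective. Consequently, every finite-dimensional $L$-semi-linear representation $V$ of $H$ in which the image of each $\sigma\in H$ spans $V$ over $L$ (equivalently, in which each $\sigma\in H$ acts by an invertible matrix in some $L$-basis) is isomorphic to $L\otimes_kW$, with $\sigma(a\otimes w)=\sigma(a)\otimes\sigma(w)$, for some $k$-linear representation $W$ of $H$. -/

import Mathlib

open scoped TensorProduct

universe u v w

/-! ### Non-abelian first cohomology of a semigroup with values in `GL_N` -/

section Cohomology

variable {k : Type u} {F : Type v} {G : Type w} [Field k] [Field F] [Algebra k F] [Monoid G]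

/-- The entrywise action of `σ : G` on `GL_N F`, where `G` acts on the field `F` by
`k`-algebra endomorphisms. -/
def glAct (φ : G →* (F →ₐ[k] F)) (N : ℕ) (σ : G) : GL (Fin N) F →* GL (Fin N) F :=
  Matrix.GeneralLinearGroup.map (φ σ : F →+* F)

/-- The set `Z¹(G, GL_N F)` of 1-cocycles: families `(f_σ)` in `GL_N F`
with `f_{στ} = f_σ · σ(f_τ)`. -/
structure Cocycle (φ : G →* (F →ₐ[k] F)) (N : ℕ) : Type (max v w) where
  val : G → GL (Fin N) F
  map_mul : ∀ σ τ : G, val (σ * τ) = val σ * glAct φ N σ (val τ)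

/-- Two cocycles `a`, `a'` are cohomologous if `a_σ = b⁻¹ · a'_σ · σ(b)` for some
`b ∈ GL_N F` and all `σ ∈ G`. -/
def cocycleSetoid (φ : G →* (F →ₐ[k] F)) (N : ℕ) : Setoid (Cocycle φ N) where
  r a a' := ∃ b : GL (Fin N) F, ∀ σ : G, a.val σ = b⁻¹ * a'.val σ * glAct φ N σ b
  iseqv :=
    { refl := fun a => ⟨1, fun σ => by simp⟩
      symm := by
        rintro a a' ⟨b, hb⟩
        refine ⟨b⁻¹, fun σ => ?_⟩
        rw [hb σ, map_inv]
        group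
      trans := by
        rintro a a' a'' ⟨b, hb⟩ ⟨c, hc⟩
        refine ⟨c * b, fun σ => ?_⟩
        rw [hb σ, hc σ, map_mul]
        group }

/-- The cohomology set `H¹(G, GL_N F)`. -/
def H1 (φ : G →* (F →ₐ[k] F)) (N : ℕ) : Type (max v w) :=
  Quotient (cocycleSetoid φ N)

/-- The trivial action of `G` on the field of constants `k`. -/
def trivialAction (G : Type w) (k : Type u) [Monoid G] [Field k] : G →* (k →ₐ[k] k) := 1

/-- A cocycle with constant values (`k` carrying the trivial `G`-action),
viewed as a cocycle with values in `GL_N F`. -/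
def Cocycle.extendScalars (φ : G →* (F →ₐ[k] F)) {N : ℕ} (f : Cocycle (trivialAction G k) N) :
    Cocycle φ N where
  val σ := Matrix.GeneralLinearGroup.map (algebraMap k F) (f.val σ)
  map_mul σ τ := by
    rw [f.map_mul σ τ, _root_.map_mul]
    congr 1
    ext i j
    simp [glAct, trivialAction]

/-- The natural map `H¹(G, GL_N k) → H¹(G, GL_N F)` induced by the inclusion
`GL_N k ⊆ GL_N F`. -/
def H1.extendScalars (φ : G →* (F →ₐ[k] F)) (N : ℕ) : H1 (trivialAction G k) N → H1 φ N :=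
  Quotient.map' (s₁ := cocycleSetoid (trivialAction G k) N) (s₂ := cocycleSetoid φ N)
    (Cocycle.extendScalars φ) (by
      rintro a a' ⟨b, hb⟩
      refine ⟨Matrix.GeneralLinearGroup.map (algebraMap k F) b, fun σ => ?_⟩
      have h : glAct φ N σ (Matrix.GeneralLinearGroup.map (algebraMap k F) b) =
          Matrix.GeneralLinearGroup.map (algebraMap k F) (glAct (trivialAction G k) N σ b) := by
        ext i j
        simp [glAct, trivialAction]
      rw [h]
      show Matrix.GeneralLinearGroup.map (algebraMap k F) (a.val σ) =
        _ * Matrix.GeneralLinearGroup.map (algebraMap k F) (a'.val σ) * _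
      rw [hb σ, map_mul, map_mul, map_inv])

/-! ### Semi-linear representations -/

/-- An `F`-semi-linear representation of the semigroup `G` on the `F`-space `V`:
an additive action with `σ(a·v) = σ(a)·σ(v)`. -/
structure SemilinearRep (φ : G →* (F →ₐ[k] F)) (V : Type*) [AddCommGroup V] [Module F V] where
  act : G →* AddMonoid.End V
  act_smul : ∀ (σ : G) (a : F) (v : V), act σ (a • v) = φ σ a • act σ v

/-- The semi-linear representation is non-degenerate if the image of each `σ : G` spans `V`
over `F`; for finite-dimensional `V` this says that the matrix of each `σ` in any basis is
invertible. -/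
def SemilinearRep.NonDegenerate {φ : G →* (F →ₐ[k] F)} {V : Type*} [AddCommGroup V] [Module F V]
    (ρ : SemilinearRep φ V) : Prop :=
  ∀ σ : G, Submodule.span F (Set.range (ρ.act σ)) = ⊤

/-- The semi-linear representation `V` is induced by a `k`-linear representation `W` of `G`:
it is isomorphic to `F ⊗_k W` with `σ(a ⊗ w) = σ(a) ⊗ σ(w)`. -/
def SemilinearRep.IsInduced {φ : G →* (F →ₐ[k] F)} {V : Type*} [AddCommGroup V] [Module F V]
    (ρ : SemilinearRep φ V) : Prop :=
  ∃ (W : Type u) (_ : AddCommGroup W) (_ : Module k W) (τ : Representation k G W)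
    (e : (F ⊗[k] W) ≃ₗ[F] V),
    ∀ (σ : G) (a : F) (x : W), ρ.act σ (e (a ⊗ₜ[k] x)) = e (φ σ a ⊗ₜ[k] τ σ x)

end Cohomology

/-! ### The semigroup `ℤ_{≠0} ⋉ kˣ` and its action on rational functions -/

/-- The semigroup `ℤ_{≠0} ⋉ kˣ`. The pair `(q, c)` stands for the endomorphism
`x ↦ c · x ^ q` of the field `k(x)`; since the composite of `(q, c)` after `(q', c')` sends `x`
to `c' · (c · x ^ q) ^ q'`, the product is `(q, c)(q', c') = (q q', c ^ q' c')`. -/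
@[ext]
structure MonomialEnd (k : Type u) [Field k] where
  /-- the exponent, a non-zero integer -/
  expo : nonZeroDivisors ℤ
  /-- the coefficient -/
  coef : kˣ

namespace MonomialEnd

variable {k : Type u} [Field k]

instance : One (MonomialEnd k) := ⟨⟨1, 1⟩⟩

instance : Mul (MonomialEnd k) :=
  ⟨fun s t => ⟨s.expo * t.expo, s.coef ^ (t.expo : ℤ) * t.coef⟩⟩

@[simp] theorem one_expo : (1 : MonomialEnd k).expo = 1 := rfl

@[simp] theorem one_coef : (1 : MonomialEnd k).coef = 1 := rfl

@[simp] theorem mul_expo (s t : MonomialEnd k) : (s * t).expo = s.expo * t.expo := rfl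

@[simp] theorem mul_coef (s t : MonomialEnd k) :
    (s * t).coef = s.coef ^ (t.expo : ℤ) * t.coef := rfl

instance : Monoid (MonomialEnd k) where
  mul_assoc a b c := by
    ext1
    · simp [mul_assoc]
    · simp [mul_zpow, zpow_mul, mul_assoc]
  one_mul a := by ext1 <;> simp
  mul_one a := by ext1 <;> simp

theorem expo_ne_zero (s : MonomialEnd k) : (s.expo : ℤ) ≠ 0 := nonZeroDivisors.coe_ne_zero _

end MonomialEnd

section RationalFunctions

/-- The field `k(x_1, …, x_n)` of rational functions in `n` variables. -/
abbrev RatFunctionField (k : Type u) [Field k] (n : ℕ) : Type u :=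
  FractionRing (MvPolynomial (Fin n) k)

variable {k : Type u} [Field k] {n : ℕ}

/-- The variable `x_j`, as an element of `k(x_1, …, x_n)`. -/
noncomputable def ratVar (k : Type u) [Field k] {n : ℕ} (j : Fin n) : RatFunctionField k n :=
  algebraMap (MvPolynomial (Fin n) k) (RatFunctionField k n) (MvPolynomial.X j)

theorem ratVar_ne_zero (j : Fin n) : ratVar k j ≠ 0 := by
  unfold ratVar
  rw [Ne, FaithfulSMul.algebraMap_eq_zero_iff]
  exact MvPolynomial.X_ne_zero j

theorem aeval_ratVar (p : MvPolynomial (Fin n) k) :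
    MvPolynomial.aeval (ratVar k) p = algebraMap _ (RatFunctionField k n) p := by
  have h : MvPolynomial.aeval (ratVar k) =
      IsScalarTower.toAlgHom k (MvPolynomial (Fin n) k) (RatFunctionField k n) := by
    ext j
    simp [ratVar]
  rw [h]
  rfl

/-- The image `c_j · x_j ^ (q_j)` of the variable `x_j` under `((q_1, c_1), …, (q_n, c_n))`. -/
noncomputable def monomialImage (s : Fin n → MonomialEnd k) (j : Fin n) : RatFunctionField k n :=
  algebraMap k (RatFunctionField k n) (s j).coef * ratVar k j ^ ((s j).expo : ℤ)

theorem algebraicIndependent_monomialImage (s : Fin n → MonomialEnd k) :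
    AlgebraicIndependent k (monomialImage s) := by
  have hX : AlgebraicIndependent k (ratVar k (n := n)) := by
    intro p q hpq
    change MvPolynomial.aeval _ p = MvPolynomial.aeval _ q at hpq
    rw [aeval_ratVar, aeval_ratVar] at hpq
    exact FaithfulSMul.algebraMap_injective _ _ hpq
  set A := Algebra.adjoin k (Set.range (monomialImage s)) with hA
  have hx : ∀ j : Fin n, IsAlgebraic A (ratVar k j) := by
    intro j
    have hy : IsAlgebraic A (monomialImage s j) :=
      isAlgebraic_algebraMap (⟨_, Algebra.subset_adjoin ⟨j, rfl⟩⟩ : A)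
    have hc : IsAlgebraic A (algebraMap k (RatFunctionField k n) ((s j).coef⁻¹ : kˣ)) :=
      isAlgebraic_algebraMap (algebraMap k A ((s j).coef⁻¹ : kˣ))
    have hz : IsAlgebraic A (ratVar k j ^ ((s j).expo : ℤ)) := by
      have h := hc.mul hy
      rw [monomialImage, ← mul_assoc, ← map_mul] at h
      simpa using h
    have hq := (s j).expo_ne_zero
    generalize ((s j).expo : ℤ) = q at hq hz
    have hz' : IsAlgebraic A (ratVar k j ^ q.natAbs) := by
      rcases Int.natAbs_eq q with h | h
      · rw [h, zpow_natCast] at hz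
        exact hz
      · rw [h, zpow_neg, zpow_natCast] at hz
        simpa using hz.inv
    exact hz'.of_pow (Int.natAbs_pos.mpr hq)
  have hpoly : ∀ p : MvPolynomial (Fin n) k,
      IsAlgebraic A (algebraMap _ (RatFunctionField k n) p) := by
    intro p
    induction p using MvPolynomial.induction_on with
    | C a =>
      have h : algebraMap _ (RatFunctionField k n) (MvPolynomial.C a : MvPolynomial (Fin n) k) =
          algebraMap A (RatFunctionField k n) (algebraMap k A a) := by
        rw [← IsScalarTower.algebraMap_apply, IsScalarTower.algebraMap_apply k
          (MvPolynomial (Fin n) k) (RatFunctionField k n)]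
        rfl
      rw [h]
      exact isAlgebraic_algebraMap _
    | add p q hp hq => rw [map_add]; exact hp.add hq
    | mul_X p j hp => rw [map_mul]; exact hp.mul (hx j)
  have : Algebra.IsAlgebraic A (RatFunctionField k n) := ⟨fun z => by
    obtain ⟨a, b, -, rfl⟩ := IsFractionRing.div_surjective (MvPolynomial (Fin n) k) z
    rw [div_eq_mul_inv]
    exact (hpoly a).mul (hpoly b).inv⟩
  exact (Algebra.IsAlgebraic.isTranscendenceBasis_of_lift_le_trdeg_of_finite k (monomialImage s)
    hX.lift_cardinalMk_le_trdeg).1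

theorem aeval_monomialImage_injective (s : Fin n → MonomialEnd k) :
    Function.Injective (MvPolynomial.aeval (R := k) (monomialImage s)) :=
  algebraicIndependent_monomialImage s

/-- The endomorphism `x_j ↦ c_j · x_j ^ (q_j)` of `k(x_1, …, x_n)` over `k`. -/
noncomputable def monomialHom (s : Fin n → MonomialEnd k) :
    RatFunctionField k n →ₐ[k] RatFunctionField k n :=
  IsFractionRing.liftAlgHom (g := MvPolynomial.aeval (monomialImage s))
    (aeval_monomialImage_injective s)

theorem monomialHom_ratVar (s : Fin n → MonomialEnd k) (j : Fin n) :
    monomialHom s (ratVar k j) = monomialImage s j := by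
  rw [monomialHom, ratVar, IsFractionRing.liftAlgHom_apply, IsFractionRing.lift_algebraMap]
  exact MvPolynomial.aeval_X _ j

theorem ratFunctionField_algHom_ext {f g : RatFunctionField k n →ₐ[k] RatFunctionField k n}
    (h : ∀ j, f (ratVar k j) = g (ratVar k j)) : f = g := by
  apply IsLocalization.algHom_ext (nonZeroDivisors (MvPolynomial (Fin n) k))
  apply MvPolynomial.algHom_ext
  exact h

/-- The action of `(ℤ_{≠0} ⋉ kˣ)^n` on `k(x_1, …, x_n)` by `k`-algebra endomorphisms. -/
noncomputable def monomialAction (k : Type u) [Field k] (n : ℕ) :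
    (Fin n → MonomialEnd k) →* (RatFunctionField k n →ₐ[k] RatFunctionField k n) where
  toFun := monomialHom
  map_one' := ratFunctionField_algHom_ext fun j => by
    simp [monomialHom_ratVar, monomialImage]
  map_mul' s t := ratFunctionField_algHom_ext fun j => by
    simp [monomialHom_ratVar, monomialImage, mul_zpow, zpow_mul]
    ring

end RationalFunctions

/-!
Both assertions come down to a canonical constant form of a non-degenerate semi-linear
representation `V` over `L = k(x_1, …, x_n)`: the set `W` of all vectors on which each of the
scalings `x_j ↦ 2 x_j` acts unipotently, that is, which are killed by a power of `σ - 1`. For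
every `σ` in the semigroup one has `(x_j ↦ 2 x_j) ∘ σ = σ ∘ (x_j ↦ 2 ^ (q_j) x_j)`, so `W` is stable
under the whole semigroup (`SemilinearRep.isUnipotentAt_act`). The main point is that `W` is a
`k`-form of `V` (`exists_unipotent_basis`). Then the semigroup acts by constant matrices in a
`k`-basis of `W`, which gives `V = L ⊗ W` and, applied to the representation attached to a cocycle,
the surjectivity. For injectivity, a representation over `k` consists of unipotent vectors: a
scaling `T` is conjugate to all its powers `T ^ q`, `q > 0`, so its eigenvalues are roots of unity,
and hence all equal to `1` (`exists_sub_one_pow_eq_zero`). So an isomorphism of two such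
representations over `L` maps constant vectors to unipotent ones, which are constant as well.

That `W` is a `k`-form is shown one variable at a time. Let `E = F(x)`, and let `C`, `Z`, `Θ_q` be
the operators on `V` over `x ↦ c x` with `c = 2`, over `x ↦ ζ x` with `ζ` a primitive root of unity
of large order `M = l ^ m`, and over `x ↦ x ^ q`; then `C Θ_q = Θ_q C ^ q` and likewise for `Z`.

* The vectors fixed by `Z` span `V`, since they contain the image of `Θ_M`; they are permuted by
  `C`. The degree of a `Z`-fixed element of `E` is divisible by `M`, so the degrees of the fixed
  vectors have large gaps (`exists_coordNorm_gap`), which the orbits under `C`, an operator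
  raising degrees by a bounded amount, cannot cross. The same holds for the order at `x = 0`. The
  denominators of `C ^ n u` only have zeros in the translates by powers of `c` of a fixed finite
  set, and, as `C ^ n u` is fixed by a power of `Z` moving these translates off themselves, the
  denominators are bounded (`isLaurent_smul_iterate`). Hence the orbits of fixed vectors with
  Laurent polynomial coordinates span finite-dimensional spaces over `F`
  (`IsRatGenerator.span_annihilated_eq_top`).
* The eigenvalues of `C` on such finite-dimensional spaces fall into finitely many classes modulo
  `c ^ ℤ`, because `C` multiplies `x` by `c`. The operator `Θ_2` squares them, so that, by
  finiteness, some power `λ ^ M` of each eigenvalue `λ` lies in `c ^ ℤ`. After application of `Θ_M`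
  all eigenvalues lie in `c ^ ℤ`, and multiplication by powers of `x` turns them into `1`:
  the unipotent vectors span `V` (`IsRatGenerator.span_unipotent_eq_top`).
* A system of unipotent vectors independent over `F` is independent over `E`, since `C` has the
  only eigenvalue `c ^ j` on `x ^ j W` (`IsRatGenerator.linearIndependent_of_unipotent`).
-/

open Polynomial WithZero

/-! ### Generators of purely transcendental extensions of degree one -/

section RationalGenerator

/-- The element `x` is transcendental over `F` and `E = F(x)`. -/
structure IsRatGenerator (F : Type*) {E : Type*} [Field F] [Field E] [Algebra F E] (x : E) :
    Prop where
  transcendental : Transcendental F x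
  exists_div : ∀ a : E, ∃ p q : F[X], q ≠ 0 ∧ a * aeval x q = aeval x p

theorem comp_scale_ne_zero {F : Type*} [Field F] {c : F} (hc : c ≠ 0) {p : F[X]} (hp : p ≠ 0) :
    p.comp (C c * X) ≠ 0 := by
  intro h
  apply hp
  ext n
  have := congrArg (coeff · n) h
  simpa [comp_C_mul_X_coeff, hc] using this

theorem natDegree_comp_scale {F : Type*} [Field F] {c : F} (hc : c ≠ 0) (p : F[X]) :
    (p.comp (C c * X)).natDegree = p.natDegree := by
  rw [natDegree_comp, natDegree_C_mul_X _ hc, mul_one]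

variable {F E : Type*} [Field F] [Field E] [Algebra F E] {x : E}

theorem eval_scale (a : F) (p : F[X]) :
    aeval x (p.comp (C a * X)) = aeval (algebraMap F E a * x) p := by
  simp [aeval_comp]

theorem map_aeval_scale {γ : E →ₐ[F] E} {c : F} (hγ : γ x = algebraMap F E c * x) (p : F[X]) :
    γ (aeval x p) = aeval x (p.comp (C c * X)) := by
  rw [eval_scale, ← hγ, aeval_algHom_apply]

namespace IsRatGenerator

variable (hx : IsRatGenerator F x)
include hx

theorem aeval_injective : Function.Injective (aeval x : F[X] →ₐ[F] E) :=
  transcendental_iff_injective.mp hx.transcendental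

theorem aeval_eq_zero {p : F[X]} : aeval x p = 0 ↔ p = 0 :=
  map_eq_zero_iff _ hx.aeval_injective

theorem ne_zero : x ≠ 0 := fun h => by
  have := hx.aeval_eq_zero (p := X)
  simp [h] at this

theorem aeval_inv_reverse (p : F[X]) :
    aeval x⁻¹ p.reverse * x ^ p.natDegree = aeval x p := by
  let : Invertible x := invertibleOfNonzero hx.ne_zero
  have := eval₂_reverse_mul_pow (algebraMap F E) x p
  rwa [invOf_eq_inv] at this

theorem inv : IsRatGenerator F x⁻¹ where
  transcendental h := hx.transcendental (by simpa using h.inv)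
  exists_div a := by
    obtain ⟨p, q, hq, h⟩ := hx.exists_div a
    refine ⟨p.reverse * X ^ q.natDegree, q.reverse * X ^ p.natDegree, by simpa using hq, ?_⟩
    rw [← hx.aeval_inv_reverse, ← hx.aeval_inv_reverse p] at h
    have hx0 := hx.ne_zero
    simp only [map_mul, map_pow, aeval_X, inv_pow]
    generalize aeval x⁻¹ q.reverse = Q at *
    generalize aeval x⁻¹ p.reverse = P at *
    field_simp
    linear_combination h

/-- The identification of `F(x)` with the field of rational functions. -/
noncomputable def toRatFunc : E →+* RatFunc F :=
  letI : Algebra F[X] E := (aeval x : F[X] →ₐ[F] E).toAlgebra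
  haveI : FaithfulSMul F[X] E := (faithfulSMul_iff_algebraMap_injective _ _).mpr hx.aeval_injective
  haveI : IsFractionRing F[X] E := IsFractionRing.of_field F[X] E (by
    intro a
    obtain ⟨p, q, hq, h⟩ := hx.exists_div a
    exact ⟨p, q, (eq_div_iff (mt hx.aeval_eq_zero.mp hq)).mpr h⟩)
  IsFractionRing.lift (A := F[X]) (K := E) (g := algebraMap F[X] (RatFunc F))
    (FaithfulSMul.algebraMap_injective _ _)

theorem toRatFunc_aeval (p : F[X]) :
    hx.toRatFunc (aeval x p) = algebraMap F[X] (RatFunc F) p := by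
  let _ : Algebra F[X] E := (aeval x : F[X] →ₐ[F] E).toAlgebra
  have : FaithfulSMul F[X] E := (faithfulSMul_iff_algebraMap_injective _ _).mpr hx.aeval_injective
  have : IsFractionRing F[X] E := IsFractionRing.of_field F[X] E (by
    intro a
    obtain ⟨p, q, hq, h⟩ := hx.exists_div a
    exact ⟨p, q, (eq_div_iff (mt hx.aeval_eq_zero.mp hq)).mpr h⟩)
  exact IsFractionRing.lift_algebraMap (FaithfulSMul.algebraMap_injective _ _) p

open Classical in
/-- The degree valuation of `E = F(x)` with respect to the generator `x`: it maps
`p(x) / q(x)` to `exp (deg p - deg q)`. For the generator `x⁻¹` it measures the order at `x = 0`. -/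
noncomputable def degVal : Valuation E ℤᵐ⁰ :=
  (RatFunc.inftyValuation F).comap hx.toRatFunc

theorem degVal_aeval {p : F[X]} (hp : p ≠ 0) : hx.degVal (aeval x p) = exp (p.natDegree : ℤ) := by
  classical
  rw [degVal, Valuation.comap_apply, hx.toRatFunc_aeval, RatFunc.inftyValuation_apply,
    RatFunc.inftyValuation.polynomial F hp]

theorem degVal_self : hx.degVal x = exp 1 := by
  simpa using hx.degVal_aeval (p := X) X_ne_zero

theorem degVal_eq {a : E} {p q : F[X]} (hp : p ≠ 0) (hq : q ≠ 0)
    (h : a * aeval x q = aeval x p) :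
    hx.degVal a = exp ((p.natDegree : ℤ) - q.natDegree) := by
  have := congrArg hx.degVal h
  rw [map_mul, hx.degVal_aeval hp, hx.degVal_aeval hq] at this
  rw [exp_sub, ← this, mul_div_cancel_right₀ _ exp_ne_zero]

/-- The order at `x = 0` of a polynomial in `x`. -/
theorem degVal_inv_aeval {p : F[X]} (hp : p ≠ 0) :
    hx.inv.degVal (aeval x p) = exp (-(p.natTrailingDegree : ℤ)) := by
  have h1 : hx.inv.degVal x = exp (-1) := by
    have := hx.inv.degVal_self
    rw [map_inv₀] at this
    rw [exp_neg, ← this, inv_inv]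
  rw [← hx.aeval_inv_reverse, map_mul, map_pow, h1,
    hx.inv.degVal_aeval (by simpa using hp), ← exp_nsmul, ← exp_add, reverse_natDegree,
    Nat.cast_sub p.natTrailingDegree_le_natDegree]
  congr 1
  simp only [nsmul_eq_mul]
  ring

theorem degVal_map {γ : E →ₐ[F] E} {c : F} (hc : c ≠ 0) (hγ : γ x = algebraMap F E c * x)
    (a : E) : hx.degVal (γ a) = hx.degVal a := by
  obtain ⟨p, q, hq, h⟩ := hx.exists_div a
  by_cases hp : p = 0
  · have : a = 0 := by
      rw [hp, map_zero] at h
      exact (mul_eq_zero.mp h).resolve_right (mt hx.aeval_eq_zero.mp hq)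
    rw [this, map_zero]
  · have h' := congrArg γ h
    rw [map_mul, map_aeval_scale hγ, map_aeval_scale hγ] at h'
    rw [hx.degVal_eq hp hq h,
      hx.degVal_eq (comp_scale_ne_zero hc hp) (comp_scale_ne_zero hc hq) h',
      natDegree_comp_scale hc, natDegree_comp_scale hc]

/-- A non-zero element of `F(x)` fixed under `x ↦ ζ x`, for `ζ` a primitive `M`-th root of unity,
has degree divisible by `M`. -/
theorem degVal_fixed {γ : E →ₐ[F] E} {ζ : F} {M : ℕ} (hζ : IsPrimitiveRoot ζ M) (hM : M ≠ 0)
    (hγ : γ x = algebraMap F E ζ * x) {a : E} (ha : a ≠ 0) (hfix : γ a = a) :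
    ∃ n : ℤ, hx.degVal a = exp (M * n) := by
  have hζ0 : ζ ≠ 0 := hζ.ne_zero hM
  obtain ⟨p, q, hq, h⟩ := hx.exists_div a
  have hp : p ≠ 0 := by
    rintro rfl
    rw [map_zero] at h
    exact (mul_ne_zero ha (mt hx.aeval_eq_zero.mp hq)) h
  have h' := congrArg γ h
  rw [map_mul, map_aeval_scale hγ, map_aeval_scale hγ, hfix] at h'
  have h2 : p * q.comp (C ζ * X) = p.comp (C ζ * X) * q := by
    apply hx.aeval_injective
    rw [map_mul, map_mul, ← h, ← h']
    ring
  -- comparison of the leading coefficients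
  have h3 := congrArg leadingCoeff h2
  have hl : ∀ r : F[X], (r.comp (C ζ * X)).leadingCoeff = r.leadingCoeff * ζ ^ r.natDegree := by
    intro r
    rw [leadingCoeff, natDegree_comp_scale hζ0, comp_C_mul_X_coeff, leadingCoeff]
  rw [leadingCoeff_mul, leadingCoeff_mul, hl, hl] at h3
  have h4 : ζ ^ q.natDegree = ζ ^ p.natDegree := by
    have := mul_ne_zero (leadingCoeff_ne_zero.mpr hp) (leadingCoeff_ne_zero.mpr hq)
    apply mul_left_cancel₀ this
    linear_combination h3
  have h5 : ζ ^ ((p.natDegree : ℤ) - q.natDegree) = 1 := by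
    rw [zpow_sub₀ hζ0, zpow_natCast, zpow_natCast, h4, div_self (pow_ne_zero _ hζ0)]
  obtain ⟨n, hn⟩ := (hζ.zpow_eq_one_iff_dvd _).mp h5
  exact ⟨n, by rw [hx.degVal_eq hp hq h, hn]⟩

/-- Laurent polynomials whose poles at `0` and `∞` have bounded order. -/
theorem exists_polynomial_of_degVal_le {b : E} {j A B : ℕ} {p : F[X]}
    (h : x ^ j * b = aeval x p) (hA : hx.degVal b ≤ exp (A : ℤ))
    (hB : hx.inv.degVal b ≤ exp (B : ℤ)) :
    ∃ r : F[X], r ∈ degreeLT F (A + B + 1) ∧ x ^ B * b = aeval x r := by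
  by_cases hb : b = 0
  · exact ⟨0, zero_mem _, by simp [hb]⟩
  have hx0 := hx.ne_zero
  have hp : p * X ^ B ≠ 0 := by
    rintro h0
    have h1 : p = 0 := by simpa using h0
    simp [h1, hb, hx0] at h
  have hb' : x ^ j * (x ^ B * b) = aeval x (p * X ^ B) := by
    rw [map_mul, ← h]
    simp
    ring
  have hvx : hx.inv.degVal x = exp (-1) := by
    simpa using hx.degVal_inv_aeval (p := X) X_ne_zero
  have hj : j ≤ (p * X ^ B).natTrailingDegree := by
    have h1 := hx.degVal_inv_aeval hp
    rw [← hb', map_mul, map_mul, map_pow, map_pow, hvx] at h1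
    have h2 : exp (-((p * X ^ B).natTrailingDegree : ℤ)) ≤
        exp (-1 : ℤ) ^ j * (exp (-1 : ℤ) ^ B * exp (B : ℤ)) := by
      rw [← h1]
      gcongr
    rw [← exp_nsmul, ← exp_nsmul, ← exp_add, ← exp_add, exp_le_exp] at h2
    simp at h2
    omega
  obtain ⟨r, hr⟩ : X ^ j ∣ p * X ^ B :=
    X_pow_dvd_iff.mpr fun d hd => coeff_eq_zero_of_lt_natTrailingDegree (hd.trans_le hj)
  have hr' : x ^ B * b = aeval x r := by
    rw [hr, map_mul, map_pow, aeval_X] at hb'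
    exact mul_left_cancel₀ (pow_ne_zero _ hx0) hb'
  have hr0 : r ≠ 0 := by
    rintro rfl
    simp at hr
    simp_all
  refine ⟨r, ?_, hr'⟩
  have h1 := hx.degVal_aeval hr0
  rw [← hr', map_mul, map_pow, hx.degVal_self] at h1
  have h2 : exp (r.natDegree : ℤ) ≤ exp (1 : ℤ) ^ B * exp (A : ℤ) := by
    rw [← h1]
    gcongr
  rw [← exp_nsmul, ← exp_add, exp_le_exp] at h2
  simp at h2
  rw [mem_degreeLT, degree_eq_natDegree hr0]
  exact_mod_cast (by omega : r.natDegree < A + B + 1)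

end IsRatGenerator
end RationalGenerator

/-! ### Norms on vector spaces over a valued field, and gaps between their values -/

section Gap

open Module

variable {E V ι : Type*} [Field E] [AddCommGroup V] [Module E V] [Fintype ι]

/-- The norm on `V` with respect to the basis `e`: the greatest valuation of a coordinate. -/
noncomputable def coordNorm (v : Valuation E ℤᵐ⁰) (e : Basis ι E V) (u : V) : ℤᵐ⁰ :=
  Finset.univ.sup fun i => v (e.repr u i)

variable (v : Valuation E ℤᵐ⁰) (e : Basis ι E V)

theorem coordNorm_le_iff {u : V} {g : ℤᵐ⁰} : coordNorm v e u ≤ g ↔ ∀ i, v (e.repr u i) ≤ g := by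
  simp [coordNorm, Finset.sup_le_iff]

theorem coordNorm_lt_iff {u : V} {g : ℤᵐ⁰} (hg : 0 < g) :
    coordNorm v e u < g ↔ ∀ i, v (e.repr u i) < g := by
  simp [coordNorm, Finset.sup_lt_iff (show (⊥ : ℤᵐ⁰) < g from hg)]

theorem le_coordNorm (u : V) (i : ι) : v (e.repr u i) ≤ coordNorm v e u :=
  (coordNorm_le_iff v e).mp le_rfl i

theorem coordNorm_smul_le (a : E) (u : V) : coordNorm v e (a • u) ≤ v a * coordNorm v e u := by
  rw [coordNorm_le_iff]
  intro i
  simp only [map_smul, Finsupp.smul_apply, smul_eq_mul, map_mul]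
  gcongr
  exact le_coordNorm v e u i

theorem coordNorm_smul (a : E) (u : V) : coordNorm v e (a • u) = v a * coordNorm v e u := by
  refine le_antisymm (coordNorm_smul_le v e a u) ?_
  by_cases ha : a = 0
  · simp [ha]
  have h := coordNorm_smul_le v e a⁻¹ (a • u)
  rw [inv_smul_smul₀ ha, map_inv₀] at h
  calc v a * coordNorm v e u ≤ v a * ((v a)⁻¹ * coordNorm v e (a • u)) := by gcongr
    _ = coordNorm v e (a • u) := mul_inv_cancel_left₀ ((map_ne_zero v).mpr ha) _

theorem coordNorm_neg (u : V) : coordNorm v e (-u) = coordNorm v e u := by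
  simp [coordNorm, Valuation.map_neg]

theorem coordNorm_sum_lt {κ : Type*} {s : Finset κ} {f : κ → V} {g : ℤᵐ⁰} (hg : 0 < g)
    (h : ∀ t ∈ s, coordNorm v e (f t) < g) : coordNorm v e (∑ t ∈ s, f t) < g := by
  rw [coordNorm_lt_iff v e hg]
  intro i
  simp only [map_sum, Finsupp.coe_finsetSum, Finset.sum_apply]
  exact v.map_sum_lt hg.ne' fun t ht => (coordNorm_lt_iff v e hg).mp (h t ht) i

theorem coordNorm_sum_le {κ : Type*} {s : Finset κ} {f : κ → V} {g : ℤᵐ⁰}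
    (h : ∀ t ∈ s, coordNorm v e (f t) ≤ g) : coordNorm v e (∑ t ∈ s, f t) ≤ g := by
  rw [coordNorm_le_iff v e]
  intro i
  simp only [map_sum, Finsupp.coe_finsetSum, Finset.sum_apply]
  exact v.map_sum_le fun t ht => (coordNorm_le_iff v e).mp (h t ht) i

/-- Vectors whose non-zero norms are pairwise distinct do not sum to zero. -/
theorem sum_ne_zero_of_coordNorm_injOn {κ : Type*} {s : Finset κ} (hs : s.Nonempty) {f : κ → V}
    (h0 : ∀ t ∈ s, coordNorm v e (f t) ≠ 0)
    (hinj : Set.InjOn (fun t => coordNorm v e (f t)) s) : ∑ t ∈ s, f t ≠ 0 := by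
  classical
  intro hsum
  obtain ⟨t, ht, hmax⟩ := s.exists_max_image (fun t => coordNorm v e (f t)) hs
  rw [← Finset.add_sum_erase s f ht] at hsum
  have h1 : coordNorm v e (∑ t ∈ s.erase t, f t) < coordNorm v e (f t) := by
    refine coordNorm_sum_lt v e (zero_lt_iff.mpr (h0 t ht)) fun t' ht' => ?_
    obtain ⟨hne, ht'⟩ := Finset.mem_erase.mp ht'
    exact lt_of_le_of_ne (hmax t' ht') fun h => hne (hinj ht' ht h)
  rw [eq_neg_of_add_eq_zero_left hsum, coordNorm_neg] at h1
  exact lt_irrefl _ h1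

/-- A semi-linear operator over a valuation-preserving endomorphism is bounded. -/
theorem exists_coordNorm_le {γ : E → E} (hγ : ∀ a, v (γ a) = v a) (A : V →+ V)
    (hA : ∀ (a : E) (u : V), A (a • u) = γ a • A u) :
    ∃ D : ℕ, ∀ u, coordNorm v e (A u) ≤ exp (D : ℤ) * coordNorm v e u := by
  obtain ⟨D, hD⟩ : ∃ D : ℕ, ∀ i, coordNorm v e (A (e i)) ≤ exp (D : ℤ) := by
    refine ⟨∑ i, (log (coordNorm v e (A (e i)))).toNat, fun i => ?_⟩
    by_cases h : coordNorm v e (A (e i)) = 0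
    · simp [h]
    rw [← exp_log h, exp_le_exp]
    refine (Int.self_le_toNat _).trans ?_
    exact_mod_cast Finset.single_le_sum
      (f := fun i => (log (coordNorm v e (A (e i)))).toNat) (fun _ _ => Nat.zero_le _)
      (Finset.mem_univ i)
  refine ⟨D, fun u => ?_⟩
  conv_lhs => rw [← e.sum_repr u, map_sum]
  refine coordNorm_sum_le v e fun i _ => ?_
  rw [hA, coordNorm_smul, hγ, mul_comm]
  gcongr
  · exact hD i
  · exact le_coordNorm v e u i

omit [Fintype ι] in
/-- A linear relation between vectors fixed by a semi-linear operator can be chosen with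
coefficients fixed by the corresponding field endomorphism. -/
theorem exists_fixed_relation {φ : E →+* E} {Z : V →+ V}
    (hZ : ∀ (a : E) (u : V), Z (a • u) = φ a • Z u) {u : ι → V} (hu : ∀ i, Z (u i) = u i)
    (hdep : ¬ LinearIndependent E u) :
    ∃ (s : ι) (a : ι →₀ E), a s = 0 ∧ (∀ i, φ (a i) = a i) ∧
      u s = a.sum fun i b => b • u i := by
  obtain ⟨J, -, -, hspan, hJ⟩ := exists_linearIndepOn_extension (K := E) (v := u)
    (s := ∅) (t := Set.univ) (by simp) (Set.subset_univ _)
  obtain ⟨s, hs⟩ : ∃ s, s ∉ J := by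
    by_contra! h
    apply hdep
    rw [← linearIndepOn_univ_iff]
    exact hJ.mono fun i _ => h i
  obtain ⟨a, haJ, ha⟩ := (Finsupp.mem_span_image_iff_linearCombination E).mp
    (hspan ⟨s, Set.mem_univ s, rfl⟩)
  have has : a s = 0 := by
    by_contra h
    exact hs (haJ (by simpa using h))
  refine ⟨s, a, has, ?_, ha.symm⟩
  -- both `a` and its image under `φ` express `u s = Z (u s)` in terms of the family `u` on `J`
  have hsub : a.mapRange φ (map_zero φ) - a = 0 := by
    refine linearIndepOn_iff.mp hJ _ (Submodule.sub_mem _ ?_ haJ) ?_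
    · intro i hi
      apply haJ
      simp only [Finset.mem_coe, Finsupp.mem_support_iff, Finsupp.mapRange_apply] at hi ⊢
      exact fun h => hi (by rw [h, map_zero])
    · rw [map_sub, ha, ← hu s, ← ha, Finsupp.linearCombination_apply,
        Finsupp.linearCombination_apply, Finsupp.sum_mapRange_index (by simp), Finsupp.sum,
        Finsupp.sum, map_sum, sub_eq_zero]
      exact Finset.sum_congr rfl fun i _ => by rw [hZ, hu]
  intro i
  simpa [sub_eq_zero] using DFunLike.congr_fun hsub i

/-- There are gaps of length `D`, beyond any bound `R`, between the norms of the vectors fixed by a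
semi-linear operator, as soon as the valuations of the fixed scalars are divisible by a number
`M ≥ (dim V + 1) * D`. Otherwise `dim V + 1` fixed vectors with norms in distinct classes modulo `M`
exist; a linear relation between them has fixed coefficients, so its terms have distinct norms. -/
theorem exists_coordNorm_gap {φ : E →+* E} {Z : V →+ V}
    (hZ : ∀ (a : E) (u : V), Z (a • u) = φ a • Z u) {M D : ℕ}
    (hφ : ∀ a, a ≠ 0 → φ a = a → ∃ n : ℤ, v a = exp (M * n))
    (hM : (Fintype.card ι + 1) * D ≤ M) (R : ℤ) :
    ∃ r : ℤ, R ≤ r ∧ ∀ u, Z u = u → coordNorm v e u < exp (r + D) → coordNorm v e u < exp r := by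
  by_contra! hcon
  choose u hu hlt hle using fun t : Fin (Fintype.card ι + 1) =>
    hcon (R + t * D : ℤ) (by simp; positivity)
  have hne : ∀ t, coordNorm v e (u t) ≠ 0 := fun t =>
    (lt_of_lt_of_le (exp_pos) (hle t)).ne'
  choose g hg using fun t =>
    (⟨log _, (exp_log (hne t)).symm⟩ : ∃ g : ℤ, coordNorm v e (u t) = exp g)
  simp only [hg, exp_lt_exp, exp_le_exp] at hlt hle
  have hdep : ¬ LinearIndependent E u := fun h => by
    have := Module.Finite.of_basis e
    have := h.fintype_card_le_finrank
    rw [finrank_eq_card_basis e] at this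
    simp at this
  obtain ⟨s, a, has, hfix, hs⟩ := exists_fixed_relation hZ hu hdep
  -- all terms of the relation have norms in distinct classes modulo `M`
  have key : ∀ t t' : Fin (Fintype.card ι + 1), ∀ n n' : ℤ,
      M * n + g t = M * n' + g t' → t = t' := by
    intro t t' n n' h
    have bound : ∀ t, R ≤ g t ∧ g t < R + M := by
      intro t
      constructor
      · exact le_trans (by simp; positivity) (hle t)
      · have h1 : (t : ℤ) * D + D ≤ M := by
          have : ((t : ℕ) + 1) * D ≤ M := (Nat.mul_le_mul_right D t.2).trans hM
          have : (((t : ℕ) + 1) * D : ℤ) ≤ M := by exact_mod_cast this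
          linarith
        linarith [hlt t]
    have hn : n = n' := by
      by_contra hne
      rcases lt_or_gt_of_ne hne with h1 | h1
      · nlinarith [bound t, bound t']
      · nlinarith [bound t, bound t']
    subst hn
    have hgg : g t = g t' := by linarith
    by_contra hne
    have hD : (0 : ℤ) ≤ D := by positivity
    rcases lt_or_gt_of_ne hne with h1 | h1
    · have h2 : ((t : ℕ) + 1 : ℤ) ≤ (t' : ℕ) := by exact_mod_cast h1
      nlinarith [hlt t, hle t']
    · have h2 : ((t' : ℕ) + 1 : ℤ) ≤ (t : ℕ) := by exact_mod_cast h1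
      nlinarith [hlt t', hle t]
  classical
  -- the coefficients of the relation, brought to one side
  let b : Fin (Fintype.card ι + 1) → E := fun t => if t = s then -1 else a t
  have hb : ∀ t ∈ insert s a.support, b t ≠ 0 ∧ φ (b t) = b t := by
    intro t ht
    by_cases hts : t = s
    · simp [b, hts]
    · have : a t ≠ 0 := by simpa [hts] using ht
      simp [b, hts, this, hfix]
  have hnorm : ∀ t ∈ insert s a.support,
      ∃ n : ℤ, coordNorm v e (b t • u t) = exp (M * n + g t) := by
    intro t ht
    obtain ⟨n, hn⟩ := hφ (b t) (hb t ht).1 (hb t ht).2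
    exact ⟨n, by rw [coordNorm_smul, hn, hg, exp_add]⟩
  refine sum_ne_zero_of_coordNorm_injOn v e (s := insert s a.support) ⟨s, by simp⟩
    (f := fun t => b t • u t) ?_ ?_ ?_
  · intro t ht
    obtain ⟨n, hn⟩ := hnorm t ht
    rw [hn]
    exact exp_ne_zero
  · intro t ht t' ht' h
    obtain ⟨n, hn⟩ := hnorm t ht
    obtain ⟨n', hn'⟩ := hnorm t' ht'
    simp only [hn, hn', exp_inj] at h
    exact key t t' n n' h
  · rw [Finset.sum_insert (by simpa using has), Finset.sum_congr rfl (g := fun t => a t • u t)]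
    · simp only [b, if_true, neg_smul, one_smul]
      rw [hs, Finsupp.sum, neg_add_cancel]
    · intro t ht
      have hts : t ≠ s := by
        rintro rfl
        simp [has] at ht
      simp [b, hts]

end Gap

/-! ### Vectors with Laurent polynomial coordinates -/

section Laurent

open Module

variable {F E : Type*} [Field F] [Field E] [Algebra F E]

/-- The algebra `F[x, x⁻¹]` of Laurent polynomials in `x`. -/
def laurentSubalgebra (F : Type*) {E : Type*} [Field F] [Field E] [Algebra F E] (x : E) :
    Subalgebra F E where
  carrier := {a | ∃ (j : ℕ) (p : F[X]), x ^ j * a = aeval x p}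
  mul_mem' := by
    rintro a b ⟨j, p, hp⟩ ⟨i, q, hq⟩
    refine ⟨j + i, p * q, ?_⟩
    rw [map_mul, ← hp, ← hq]
    ring
  add_mem' := by
    rintro a b ⟨j, p, hp⟩ ⟨i, q, hq⟩
    refine ⟨j + i, X ^ i * p + X ^ j * q, ?_⟩
    simp only [map_add, map_mul, map_pow, aeval_X]
    rw [← hp, ← hq]
    ring
  algebraMap_mem' c := ⟨0, C c, by simp⟩

variable {x : E}

theorem aeval_mem_laurentSubalgebra (p : F[X]) : aeval x p ∈ laurentSubalgebra F x :=
  ⟨0, p, by simp⟩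

theorem map_mem_laurentSubalgebra {γ : E →ₐ[F] E} {c : F} (hc : c ≠ 0)
    (hγ : γ x = algebraMap F E c * x) {a : E} (ha : a ∈ laurentSubalgebra F x) :
    γ a ∈ laurentSubalgebra F x := by
  obtain ⟨j, p, hp⟩ := ha
  refine ⟨j, C (c⁻¹ ^ j) * p.comp (C c * X), ?_⟩
  have h := congrArg γ hp
  rw [map_mul, map_pow, hγ, map_aeval_scale hγ] at h
  rw [map_mul, ← h, aeval_C, map_pow, map_inv₀]
  have : algebraMap F E c ≠ 0 := by simpa using hc
  rw [inv_pow, mul_pow]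
  field_simp

theorem coeff_zero_comp_scale (c : F) (p : F[X]) : (p.comp (C c * X)).coeff 0 = p.coeff 0 := by
  simp [comp_C_mul_X_coeff]

theorem comp_scale_comp_scale (a b : F) (p : F[X]) :
    (p.comp (C a * X)).comp (C b * X) = p.comp (C (a * b) * X) := by
  rw [comp_assoc]
  simp [mul_assoc]

variable {V ι : Type*} [AddCommGroup V] [Module E V]

/-- The coordinates of `u` in the basis `e` are Laurent polynomials in `x`. -/
def IsLaurent (F : Type*) {E V ι : Type*} [Field F] [Field E] [Algebra F E] [AddCommGroup V]
    [Module E V] (x : E) (e : Basis ι E V) (u : V) : Prop :=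
  ∀ i, e.repr u i ∈ laurentSubalgebra F x

variable {e : Basis ι E V}

theorem IsLaurent.add {u w : V} (hu : IsLaurent F x e u) (hw : IsLaurent F x e w) :
    IsLaurent F x e (u + w) := fun i => by
  simpa using add_mem (hu i) (hw i)

theorem IsLaurent.smul {a : E} (ha : a ∈ laurentSubalgebra F x) {u : V}
    (hu : IsLaurent F x e u) : IsLaurent F x e (a • u) := fun i => by
  simpa using mul_mem ha (hu i)

theorem IsLaurent.sum {κ : Type*} {s : Finset κ} {f : κ → V}
    (h : ∀ t ∈ s, IsLaurent F x e (f t)) : IsLaurent F x e (∑ t ∈ s, f t) := fun i => by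
  simpa using sum_mem fun t ht => h t ht i

variable [Fintype ι]

/-- A polynomial clearing the denominators of finitely many vectors. As powers of `x` are
invertible Laurent polynomials, it can be taken not to vanish at `0`. -/
theorem IsRatGenerator.exists_isLaurent_smul (hx : IsRatGenerator F x) {κ : Type*} [Fintype κ]
    (f : κ → V) : ∃ Q : F[X], Q.coeff 0 ≠ 0 ∧ ∀ t, IsLaurent F x e (aeval x Q • f t) := by
  classical
  have hx0 := hx.ne_zero
  choose p q hq h using hx.exists_div
  obtain ⟨Q, hQ0, hQ⟩ : ∃ Q : F[X], Q ≠ 0 ∧ ∀ t, IsLaurent F x e (aeval x Q • f t) := by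
    refine ⟨∏ ti : κ × ι, q (e.repr (f ti.1) ti.2),
      Finset.prod_ne_zero_iff.mpr fun ti _ => hq _, fun t i => ?_⟩
    rw [← Finset.prod_erase_mul _ _ (Finset.mem_univ (t, i)), map_smul, Finsupp.smul_apply,
      smul_eq_mul, map_mul, mul_assoc, mul_comm (aeval x (q _)), h, ← map_mul]
    exact aeval_mem_laurentSubalgebra _
  obtain ⟨a, R, hR⟩ : ∃ (a : ℕ) (R : F[X]), Q = X ^ a * R ∧ R.coeff 0 ≠ 0 := by
    obtain ⟨R, hR, hR'⟩ := exists_eq_pow_rootMultiplicity_mul_and_not_dvd Q hQ0 0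
    rw [map_zero, sub_zero] at hR hR'
    exact ⟨_, R, hR, fun h => hR' (X_dvd_iff.mpr h)⟩
  refine ⟨R, hR.2, fun t => ?_⟩
  have h1 : aeval x R • f t = (x⁻¹ ^ a) • (aeval x Q • f t) := by
    rw [hR.1, smul_smul]
    congr 1
    simp
    field_simp
  rw [h1]
  refine (hQ t).smul ⟨a, 1, ?_⟩
  simp [hx0]

/-- If `Q` clears the denominators of the images of the basis vectors under a semi-linear
operator, it clears those of the images of all Laurent vectors. -/
theorem IsLaurent.map {γ : E →ₐ[F] E} {c : F} (hc : c ≠ 0) (hγ : γ x = algebraMap F E c * x)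
    (A : V →+ V) (hA : ∀ (a : E) (u : V), A (a • u) = γ a • A u) {Q : F[X]}
    (hQ : ∀ i, IsLaurent F x e (aeval x Q • A (e i))) {u : V} (hu : IsLaurent F x e u) :
    IsLaurent F x e (aeval x Q • A u) := by
  rw [← e.sum_repr u, map_sum, Finset.smul_sum]
  refine IsLaurent.sum fun i _ => ?_
  rw [hA, smul_comm]
  exact (hQ i).smul (map_mem_laurentSubalgebra hc hγ (hu i))

end Laurent

/-! ### Boundedness of the denominators along orbits -/

section Denominators

open Module

variable {F : Type*} [Field F]

/-- Let `c` have infinite order. For a root of unity `ζ` of large order, some power of `ζ` moves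
the zeros of `Q` away from all translates of these zeros under powers of `c`: each pair of
zeros excludes at most one power of `ζ`. -/
theorem exists_isCoprime_comp_scale {c : F} (hc0 : c ≠ 0) (hc : ∀ n : ℤ, c ^ n = 1 → n = 0)
    {Q : F[X]} (hQ : Q.coeff 0 ≠ 0) {ζ : F} {M : ℕ} (hζ : IsPrimitiveRoot ζ M)
    (hM : Q.natDegree ^ 2 < M) :
    ∃ t : ℕ, ∀ i j : ℕ, IsCoprime (Q.comp (C (c ^ i) * X)) (Q.comp (C (c ^ j * ζ ^ t) * X)) := by
  classical
  by_contra! hcon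
  have hQ0 : Q ≠ 0 := by
    rintro rfl
    simp at hQ
  let K := AlgebraicClosure F
  have key : ∀ t : Fin M, ∃ (i j : ℕ) (μ : K), aeval (algebraMap F K (c ^ i) * μ) Q = 0 ∧
      aeval (algebraMap F K (c ^ j * ζ ^ (t : ℕ)) * μ) Q = 0 := by
    intro t
    obtain ⟨i, j, hij⟩ := hcon t
    rw [isCoprime_iff_aeval_ne_zero_of_isAlgClosed F K] at hij
    push Not at hij
    obtain ⟨μ, h1, h2⟩ := hij
    rw [eval_scale] at h1 h2
    exact ⟨i, j, μ, h1, h2⟩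
  choose i j μ h1 h2 using key
  have hroots : ∀ α : K, aeval α Q = 0 → α ∈ (Q.aroots K).toFinset := fun α h => by
    simpa [hQ0] using h
  let f : Fin M → K × K := fun t =>
    (algebraMap F K (c ^ i t) * μ t, algebraMap F K (c ^ j t * ζ ^ (t : ℕ)) * μ t)
  have hf : ∀ t, f t ∈ (Q.aroots K).toFinset ×ˢ (Q.aroots K).toFinset := fun t =>
    Finset.mem_product.mpr ⟨hroots _ (h1 t), hroots _ (h2 t)⟩
  have hM0 : M ≠ 0 := by omega
  have hζ0 := hζ.ne_zero hM0
  -- the two zeros determine `c ^ (j t - i t) * ζ ^ t`, hence `ζ ^ t`, as `c` has infinite order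
  have hinj : Function.Injective f := by
    intro t t' h
    have e1 := congrArg Prod.fst h
    have e2 := congrArg Prod.snd h
    simp only [f] at e1 e2
    have hμ : μ t ≠ 0 := by
      intro h0
      have := h1 t
      rw [h0, mul_zero, aeval_def, eval₂_at_zero] at this
      exact hQ (by simpa using this)
    have hμ' : μ t' ≠ 0 := by
      intro h0
      have := h1 t'
      rw [h0, mul_zero, aeval_def, eval₂_at_zero] at this
      exact hQ (by simpa using this)
    have e3 : c ^ (j t) * ζ ^ (t : ℕ) * c ^ (i t') = c ^ (j t') * ζ ^ (t' : ℕ) * c ^ (i t) := by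
      apply (algebraMap F K).injective
      apply mul_right_cancel₀ (mul_ne_zero hμ hμ')
      simp only [map_mul] at e1 e2 ⊢
      linear_combination (algebraMap F K (c ^ i t') * μ t') * e2 -
        (algebraMap F K (c ^ j t') * algebraMap F K (ζ ^ (t' : ℕ)) * μ t') * e1
    have e4 := congrArg (· ^ M) e3
    simp only [mul_pow, ← pow_mul, mul_comm _ M, pow_mul ζ M, hζ.pow_eq_one, one_pow, mul_one]
      at e4
    have e5 : c ^ (((M * j t + M * i t' : ℕ) : ℤ) - ((M * j t' + M * i t : ℕ) : ℤ)) = 1 := by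
      rw [zpow_sub₀ hc0, zpow_natCast, zpow_natCast, pow_add, pow_add, e4,
        div_self (mul_ne_zero (pow_ne_zero _ hc0) (pow_ne_zero _ hc0))]
    have e6 : j t + i t' = j t' + i t := by
      have h7 := hc _ e5
      have h8 : M * (j t + i t') = M * (j t' + i t) := by
        rw [mul_add, mul_add]
        omega
      exact Nat.eq_of_mul_eq_mul_left (Nat.pos_of_ne_zero hM0) h8
    have e7 : ζ ^ (t : ℕ) = ζ ^ (t' : ℕ) := by
      apply mul_left_cancel₀ (pow_ne_zero (j t + i t') hc0)
      conv_rhs => rw [e6]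
      rw [pow_add, pow_add]
      linear_combination e3
    exact Fin.ext (hζ.pow_inj t.2 t'.2 e7)
  have hcard := Finset.card_le_card_of_injOn f (s := Finset.univ) (fun t _ => hf t) hinj.injOn
  rw [Finset.card_univ, Fintype.card_fin, Finset.card_product] at hcard
  have h3 : (Q.aroots K).toFinset.card ≤ Q.natDegree :=
    (Multiset.toFinset_card_le _).trans ((card_roots' _).trans natDegree_map_le)
  nlinarith [Nat.mul_le_mul h3 h3]

variable {E : Type*} [Field E] [Algebra F E] {x : E}
  {V ι : Type*} [AddCommGroup V] [Module E V] [Fintype ι] {e : Basis ι E V}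

/-- The vectors `Cⁿ u` have bounded denominators if `u` is fixed by an operator `A` which commutes
with `C` and moves the zeros of the denominators of `C` away from each other: the denominators of
`Cⁿ u = A (Cⁿ u)` divide two coprime polynomials, up to a fixed factor `h`. -/
theorem isLaurent_smul_iterate {γ φ : E →ₐ[F] E} {c η : F} (hc : c ≠ 0) (hη : η ≠ 0)
    (hγ : γ x = algebraMap F E c * x) (hφ : φ x = algebraMap F E η * x) {C A : V →+ V}
    (hC : ∀ (a : E) (u : V), C (a • u) = γ a • C u)
    (hA : ∀ (a : E) (u : V), A (a • u) = φ a • A u) {Q h : F[X]}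
    (hQ : ∀ i, IsLaurent F x e (aeval x Q • C (e i)))
    (hh : ∀ i, IsLaurent F x e (aeval x h • A (e i)))
    (hcop : ∀ i j : ℕ, IsCoprime (Q.comp (Polynomial.C (c ^ i) * X))
      (Q.comp (Polynomial.C (c ^ j * η) * X)))
    {u : V} (hu : IsLaurent F x e u) (hfix : ∀ n, A (C^[n] u) = C^[n] u) (n : ℕ) :
    IsLaurent F x e (aeval x h • C^[n] u) := by
  -- `s n` clears the denominators of `C^[n] u`
  let s : ℕ → F[X] := fun n => ∏ i ∈ Finset.range n, Q.comp (Polynomial.C (c ^ i) * X)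
  have hs : ∀ n, s (n + 1) = (s n).comp (Polynomial.C c * X) * Q := by
    intro n
    simp only [s]
    rw [Finset.prod_range_succ', prod_comp]
    congr 1
    · refine Finset.prod_congr rfl fun i _ => ?_
      rw [comp_scale_comp_scale, pow_succ]
    · simp
  have h1 : ∀ n, IsLaurent F x e (aeval x (s n) • C^[n] u) := by
    intro n
    induction n with
    | zero => simpa [s] using hu
    | succ n ih =>
      have := ih.map hc hγ C hC hQ
      rw [hC, map_aeval_scale hγ, smul_smul, ← map_mul, mul_comm, ← hs] at this
      rwa [Function.iterate_succ_apply']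
  have h2 := (h1 n).map hη hφ A hA hh
  rw [hA, map_aeval_scale hφ, hfix] at h2
  have hco : IsCoprime (s n) ((s n).comp (Polynomial.C η * X)) := by
    simp only [s]
    rw [prod_comp]
    refine IsCoprime.prod_left fun i _ => IsCoprime.prod_right fun j _ => ?_
    rw [comp_scale_comp_scale]
    exact hcop i j
  obtain ⟨α, β, hαβ⟩ := hco
  have h3 : aeval x h • C^[n] u = aeval x (h * α) • (aeval x (s n) • C^[n] u) +
      aeval x β • (aeval x h • (aeval x ((s n).comp (Polynomial.C η * X)) • C^[n] u)) := by
    rw [smul_smul, smul_smul, smul_smul, ← map_mul, ← map_mul, ← map_mul, ← add_smul, ← map_add]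
    congr 2
    linear_combination -h * hαβ
  rw [h3]
  exact ((h1 n).smul (aeval_mem_laurentSubalgebra _)).add
    (h2.smul (aeval_mem_laurentSubalgebra _))

end Denominators

/-! ### Vectors with finite-dimensional orbits -/

section FiniteOrbits

open Module

/-- The orbit of a vector fixed by `Z` under an operator `C` commuting with `Z` is bounded: a gap
in the norms of the fixed vectors cannot be crossed. -/
theorem exists_coordNorm_iterate_le {E V ι : Type*} [Field E] [AddCommGroup V] [Module E V]
    [Fintype ι] (v : Valuation E ℤᵐ⁰) (e : Basis ι E V) {φ : E →+* E} {Z C : V →+ V}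
    (hZ : ∀ (a : E) (u : V), Z (a • u) = φ a • Z u) {M D : ℕ}
    (hφ : ∀ a, a ≠ 0 → φ a = a → ∃ n : ℤ, v a = exp (M * n))
    (hM : (Fintype.card ι + 1) * D ≤ M)
    (hD : ∀ u, coordNorm v e (C u) ≤ exp (D : ℤ) * coordNorm v e u)
    {u : V} (hu : ∀ n, Z (C^[n] u) = C^[n] u) :
    ∃ A : ℕ, ∀ n, coordNorm v e (C^[n] u) ≤ exp (A : ℤ) := by
  obtain ⟨r, hr, hgap⟩ := exists_coordNorm_gap v e hZ hφ hM (log (coordNorm v e u) + 1)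
  have h : ∀ n, coordNorm v e (C^[n] u) < exp r := by
    intro n
    induction n with
    | zero =>
      by_cases h0 : coordNorm v e u = 0
      · simp [h0]
      · rw [Function.iterate_zero_apply, ← exp_log h0, exp_lt_exp]
        omega
    | succ n ih =>
      refine hgap _ (hu _) ?_
      rw [Function.iterate_succ_apply', add_comm, exp_add]
      exact (hD _).trans_lt (mul_lt_mul_of_pos_left ih exp_pos)
  refine ⟨r.toNat, fun n => (h n).le.trans ?_⟩
  rw [exp_le_exp]
  exact Int.self_le_toNat r

variable {F E : Type*} [Field F] [Field E] [Algebra F E] {x : E}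
  {V ι : Type*} [AddCommGroup V] [Module E V] [Module F V] [IsScalarTower F E V] [Fintype ι]

/-- The vectors with bounded denominators and bounded poles at `0` and `∞` lie in a
finite-dimensional space. -/
theorem IsRatGenerator.exists_finite_submodule (hx : IsRatGenerator F x) (e : Basis ι E V)
    {h : F[X]} (hh : h ≠ 0) (A B : ℕ) :
    ∃ Y : Submodule F V, Module.Finite F Y ∧ ∀ w, IsLaurent F x e (aeval x h • w) →
      coordNorm hx.degVal e w ≤ exp (A : ℤ) → coordNorm hx.inv.degVal e w ≤ exp (B : ℤ) →
      w ∈ Y := by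
  let g : (ι → degreeLT F (A + h.natDegree + B + 1)) →ₗ[F] V :=
    ∑ i, (((LinearMap.toSpanSingleton E V ((x ^ B * aeval x h)⁻¹ • e i)).restrictScalars F).comp
      (((aeval x : F[X] →ₐ[F] E).toLinearMap).comp (Submodule.subtype _))).comp
        (LinearMap.proj i)
  have hx0 := hx.ne_zero
  have hh0 : aeval x h ≠ 0 := mt hx.aeval_eq_zero.mp hh
  refine ⟨LinearMap.range g, inferInstance, fun w hw hA hB => ?_⟩
  have key : ∀ i, ∃ r : F[X], r ∈ degreeLT F (A + h.natDegree + B + 1) ∧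
      x ^ B * (aeval x h * e.repr w i) = aeval x r := by
    intro i
    obtain ⟨j, p, hp⟩ := hw i
    rw [map_smul, Finsupp.smul_apply, smul_eq_mul] at hp
    refine hx.exists_polynomial_of_degVal_le hp ?_ ?_
    · rw [map_mul, hx.degVal_aeval hh, Nat.cast_add, add_comm (A : ℤ), exp_add]
      gcongr
      exact (le_coordNorm _ e w i).trans hA
    · rw [map_mul, hx.degVal_inv_aeval hh]
      calc _ ≤ exp (-(h.natTrailingDegree : ℤ)) * exp (B : ℤ) := by
            gcongr
            exact (le_coordNorm _ e w i).trans hB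
        _ ≤ exp (B : ℤ) := by
            rw [← exp_add, exp_le_exp]
            omega
  choose r hr hr' using key
  refine ⟨fun i => ⟨r i, hr i⟩, ?_⟩
  conv_rhs => rw [← e.sum_repr w]
  simp only [g, LinearMap.sum_apply]
  refine Finset.sum_congr rfl fun i _ => ?_
  simp only [LinearMap.comp_apply, LinearMap.restrictScalars_apply,
    LinearMap.toSpanSingleton_apply, LinearMap.proj_apply, Submodule.subtype_apply,
    AlgHom.toLinearMap_apply]
  rw [← hr' i, smul_smul]
  congr 1
  field_simp

omit [Fintype ι] in
/-- A vector whose orbit under `C` lies in a finite-dimensional space is annihilated by a non-zero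
polynomial in `C`. -/
theorem exists_aeval_apply_eq_zero {F V : Type*} [Field F] [AddCommGroup V] [Module F V]
    {C : Module.End F V} {u : V} {Y : Submodule F V} (hY : Module.Finite F Y)
    (hu : ∀ n, (C ^ n) u ∈ Y) : ∃ p : F[X], p ≠ 0 ∧ aeval C p u = 0 := by
  by_contra! hcon
  let g : F[X] →ₗ[F] V := (LinearMap.applyₗ u).comp (aeval C : F[X] →ₐ[F] _).toLinearMap
  have hg : ∀ p, g p = aeval C p u := fun p => rfl
  have hmem : ∀ p, g p ∈ Y := by
    intro p
    rw [hg, aeval_eq_sum_range, LinearMap.sum_apply]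
    exact Submodule.sum_mem _ fun i _ => Y.smul_mem _ (hu i)
  have hinj : Function.Injective (g.codRestrict Y hmem) := by
    rw [injective_iff_map_eq_zero]
    intro p hp
    by_contra h0
    exact hcon p h0 (congrArg Subtype.val hp)
  exact Polynomial.not_finite (Module.Finite.of_injective _ hinj)

/-- A non-zero scalar which is fixed under `x ↦ ζ x` and divisible by a given polynomial. -/
theorem IsRatGenerator.exists_fixed_multiple (hx : IsRatGenerator F x) {φ : E →ₐ[F] E} {ζ : F}
    {M : ℕ} (hM : M ≠ 0) (hζ : IsPrimitiveRoot ζ M) (hφ : φ x = algebraMap F E ζ * x) {Q : F[X]}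
    (hQ : Q ≠ 0) : ∃ R : F[X], aeval x (R * Q) ≠ 0 ∧ φ (aeval x (R * Q)) = aeval x (R * Q) := by
  obtain ⟨m, rfl⟩ := Nat.exists_eq_succ_of_ne_zero hM
  have hζ0 := hζ.ne_zero hM
  refine ⟨∏ t ∈ Finset.range m, Q.comp (C (ζ ^ (t + 1)) * X), ?_, ?_⟩
  · rw [Ne, hx.aeval_eq_zero]
    exact mul_ne_zero (Finset.prod_ne_zero_iff.mpr fun t _ =>
      comp_scale_ne_zero (pow_ne_zero _ hζ0) hQ) hQ
  · have h1 : (∏ t ∈ Finset.range m, Q.comp (C (ζ ^ (t + 1)) * X)) * Q =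
        ∏ t ∈ Finset.range (m + 1), Q.comp (C (ζ ^ t) * X) := by
      rw [Finset.prod_range_succ']
      simp
    rw [map_aeval_scale hφ]
    congr 1
    conv_lhs => rw [h1, prod_comp, Finset.prod_range_succ]
    simp only [comp_scale_comp_scale, ← pow_succ]
    rw [hζ.pow_eq_one]
    simp

omit [IsScalarTower F E V] in
theorem pow_semilinear {φ : E →ₐ[F] E} {ζ : F} (hφ : φ x = algebraMap F E ζ * x)
    {Z : Module.End F V} (hZ : ∀ (a : E) (u : V), Z (a • u) = φ a • Z u) (t : ℕ) :
    (φ ^ t) x = algebraMap F E (ζ ^ t) * x ∧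
      ∀ (a : E) (u : V), (Z ^ t) (a • u) = (φ ^ t) a • (Z ^ t) u := by
  induction t with
  | zero => simp
  | succ t ih =>
    constructor
    · rw [pow_succ', AlgHom.mul_apply, ih.1, map_mul, hφ, AlgHom.commutes, pow_succ, map_mul]
      ring
    · intro a u
      rw [pow_succ', pow_succ', Module.End.mul_apply, ih.2, hZ]
      rfl

/-- The vectors annihilated by non-zero polynomials in `C` span `V`, if `C` commutes with
semi-linear operators `Z` over `x ↦ ζ x`, for roots of unity `ζ` of arbitrarily large orders, whose
fixed vectors span `V`. -/
theorem IsRatGenerator.span_annihilated_eq_top (hx : IsRatGenerator F x) [FiniteDimensional E V]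
    {γ : E →ₐ[F] E} {c : F} (hc0 : c ≠ 0) (hc : ∀ n : ℤ, c ^ n = 1 → n = 0)
    (hγ : γ x = algebraMap F E c * x) {T : Module.End F V}
    (hT : ∀ (a : E) (u : V), T (a • u) = γ a • T u)
    (hroots : ∀ B : ℕ, ∃ (M : ℕ) (ζ : F) (φ : E →ₐ[F] E) (Z : Module.End F V), B ≤ M ∧
      IsPrimitiveRoot ζ M ∧ φ x = algebraMap F E ζ * x ∧
      (∀ (a : E) (u : V), Z (a • u) = φ a • Z u) ∧ (∀ u, Z (T u) = T (Z u)) ∧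
      Submodule.span E {u | Z u = u} = ⊤) :
    Submodule.span E {u : V | ∃ p : F[X], p ≠ 0 ∧ aeval T p u = 0} = ⊤ := by
  let e := Module.finBasis E V
  obtain ⟨Q, hQ0, hQ⟩ := hx.exists_isLaurent_smul (e := e) fun i => T (e i)
  obtain ⟨D, hD⟩ := exists_coordNorm_le hx.degVal e (hx.degVal_map hc0 hγ) T.toAddMonoidHom hT
  have hγ' : γ x⁻¹ = algebraMap F E c⁻¹ * x⁻¹ := by
    rw [map_inv₀, hγ, mul_inv, map_inv₀]
  obtain ⟨D', hD'⟩ := exists_coordNorm_le hx.inv.degVal e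
    (hx.inv.degVal_map (inv_ne_zero hc0) hγ') T.toAddMonoidHom hT
  obtain ⟨M, ζ, φ, Z, hM, hζ, hφ, hZ, hcomm, hspan⟩ :=
    hroots (Q.natDegree ^ 2 + 1 + (Fintype.card (Fin (finrank E V)) + 1) * D +
      (Fintype.card (Fin (finrank E V)) + 1) * D')
  have hM0 : M ≠ 0 := by omega
  have hζ0 := hζ.ne_zero hM0
  have hφ' : φ x⁻¹ = algebraMap F E ζ⁻¹ * x⁻¹ := by
    rw [map_inv₀, hφ, mul_inv, map_inv₀]
  obtain ⟨t, ht⟩ := exists_isCoprime_comp_scale hc0 hc hQ0 hζ (by omega)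
  obtain ⟨hφt, hZt⟩ := pow_semilinear hφ hZ t
  obtain ⟨h, hh0, hh⟩ := hx.exists_isLaurent_smul (e := e) fun i => (Z ^ t) (e i)
  have hh0' : h ≠ 0 := by
    rintro rfl
    simp at hh0
  -- fixed vectors with Laurent coordinates have finite-dimensional orbits
  have main : ∀ u, Z u = u → IsLaurent F x e u → ∃ p : F[X], p ≠ 0 ∧ aeval T p u = 0 := by
    intro u hfix hu
    have hpow : ∀ n (w : V), (T ^ n) w = T.toAddMonoidHom^[n] w := by
      intro n w
      rw [Module.End.coe_pow]
      rfl
    have hfixn : ∀ n, Z ((T ^ n) u) = (T ^ n) u := by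
      intro n
      induction n with
      | zero => simpa using hfix
      | succ n ih => rw [pow_succ', Module.End.mul_apply, hcomm, ih]
    have hfixt : ∀ n, (Z ^ t) ((T ^ n) u) = (T ^ n) u := by
      intro n
      rw [Module.End.coe_pow]
      exact Function.iterate_fixed (hfixn n) t
    obtain ⟨A, hA⟩ := exists_coordNorm_iterate_le hx.degVal e (φ := φ.toRingHom)
      (Z := Z.toAddMonoidHom) (C := T.toAddMonoidHom) hZ
      (fun a ha hfa => hx.degVal_fixed hζ hM0 hφ ha hfa) (by omega) hD (u := u)
      (fun n => by rw [← hpow]; exact hfixn n)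
    obtain ⟨B, hB⟩ := exists_coordNorm_iterate_le hx.inv.degVal e (φ := φ.toRingHom)
      (Z := Z.toAddMonoidHom) (C := T.toAddMonoidHom) hZ
      (fun a ha hfa => hx.inv.degVal_fixed hζ.inv hM0 hφ' ha hfa) (by omega) hD' (u := u)
      (fun n => by rw [← hpow]; exact hfixn n)
    obtain ⟨Y, hYfin, hY⟩ := hx.exists_finite_submodule e hh0' A B
    refine exists_aeval_apply_eq_zero hYfin fun n => ?_
    rw [hpow]
    refine hY _ ?_ (hA n) (hB n)
    exact isLaurent_smul_iterate hc0 (pow_ne_zero t hζ0) hγ hφt (C := T.toAddMonoidHom)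
      (A := (Z ^ t).toAddMonoidHom) hT hZt hQ hh ht hu
      (fun n => by rw [← hpow]; exact hfixt n) n
  rw [eq_top_iff, ← hspan, Submodule.span_le]
  intro u hu
  obtain ⟨P, hP0, hP⟩ := hx.exists_isLaurent_smul (e := e) fun _ : Unit => u
  have hP0' : P ≠ 0 := by
    rintro rfl
    simp at hP0
  obtain ⟨R, hR0, hR⟩ := hx.exists_fixed_multiple hM0 hζ hφ hP0'
  have h1 := main (aeval x (R * P) • u) (by rw [hZ, hR, show Z u = u from hu]) (by
    rw [map_mul, ← smul_smul]
    exact (hP ()).smul (aeval_mem_laurentSubalgebra _))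
  have h2 := Submodule.smul_mem _ (aeval x (R * P))⁻¹ (Submodule.subset_span (R := E)
    (s := {u : V | ∃ p : F[X], p ≠ 0 ∧ aeval T p u = 0}) h1)
  rwa [inv_smul_smul₀ hR0] at h2

end FiniteOrbits

/-! ### Annihilating polynomials of a semi-linear operator -/

section Spectrum

open Module

variable {F : Type*} [Field F]

theorem isCoprime_comp_scale_of_irreducible {π : F[X]} (hπ : Irreducible π) (h0 : π.coeff 0 ≠ 0)
    {a b : F} (ha : a ≠ 0) (hab : ∀ n : ℕ, n ≠ 0 → a ^ n ≠ b ^ n) :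
    IsCoprime (π.comp (C a * X)) (π.comp (C b * X)) := by
  let K := AlgebraicClosure F
  rw [isCoprime_iff_aeval_ne_zero_of_isAlgClosed F K]
  by_contra! hcon
  obtain ⟨μ, h1, h2⟩ := hcon
  rw [eval_scale] at h1 h2
  have hdvd : π ∣ π.comp (C (b / a) * X) := by
    refine (hπ.isCoprime_or_dvd _).resolve_left fun hco => ?_
    rcases aeval_ne_zero_of_isCoprime hco (algebraMap F K a * μ) with h | h
    · exact h h1
    · apply h
      rw [eval_scale, map_div₀, ← mul_assoc, div_mul_cancel₀ _ (by simpa using ha)]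
      exact h2
  have hb : b / a ≠ 0 := by
    rintro hb
    have hb0 : b = 0 := by simpa [ha] using hb
    rw [hb0, map_zero, zero_mul, aeval_def, eval₂_at_zero] at h2
    exact h0 (by simpa using h2)
  obtain ⟨g, hg⟩ := hdvd
  have hπ0 := hπ.ne_zero
  have hg0 : g ≠ 0 := by
    rintro rfl
    exact comp_scale_ne_zero hb hπ0 (by simpa using hg)
  have hdeg : g.natDegree = 0 := by
    have := congrArg natDegree hg
    rw [natDegree_comp_scale hb, natDegree_mul hπ0 hg0] at this
    omega
  obtain ⟨u, rfl⟩ := natDegree_eq_zero.mp hdeg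
  have hu : u = 1 := by
    have := congrArg (coeff · 0) hg
    simp only [coeff_zero_comp_scale, coeff_mul_C] at this
    exact mul_left_cancel₀ h0 (by rw [← this, mul_one])
  have hlc := congrArg (coeff · π.natDegree) hg
  simp only [hu, comp_C_mul_X_coeff, coeff_mul_C] at hlc
  have h3 : (b / a) ^ π.natDegree = 1 :=
    mul_left_cancel₀ (leadingCoeff_ne_zero.mpr hπ0) hlc
  rw [div_pow, div_eq_one_iff_eq (pow_ne_zero _ ha)] at h3
  exact hab _ hπ.natDegree_pos.ne' h3.symm

section Module

variable {V : Type*} [AddCommGroup V] [Module F V] (T : Module.End F V)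

theorem aeval_mul_apply (p q : F[X]) (w : V) : aeval T (p * q) w = aeval T p (aeval T q w) := by
  rw [map_mul, Module.End.mul_apply]

theorem aeval_apply_eq_zero_of_dvd {p q : F[X]} (h : p ∣ q) {w : V} (hw : aeval T p w = 0) :
    aeval T q w = 0 := by
  obtain ⟨r, rfl⟩ := h
  rw [mul_comm, aeval_mul_apply, hw, map_zero]

theorem eq_zero_of_isCoprime {p q : F[X]} (h : IsCoprime p q) {w : V} (hp : aeval T p w = 0)
    (hq : aeval T q w = 0) : w = 0 := by
  obtain ⟨a, b, hab⟩ := h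
  have : aeval T (a * p + b * q) w = 0 := by
    rw [map_add, LinearMap.add_apply, aeval_mul_apply, aeval_mul_apply, hp, hq, map_zero,
      map_zero, add_zero]
  simpa [hab] using this

theorem eq_zero_of_sum_eq_zero_of_isCoprime {κ : Type*} {s : Finset κ} {w : κ → V} {π : κ → F[X]}
    (hπ : ∀ i ∈ s, ∀ j ∈ s, i ≠ j → IsCoprime (π i) (π j)) (hw : ∀ i ∈ s, aeval T (π i) (w i) = 0)
    (hsum : ∑ i ∈ s, w i = 0) : ∀ i ∈ s, w i = 0 := by
  classical
  intro i hi
  refine eq_zero_of_isCoprime T (q := ∏ j ∈ s.erase i, π j)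
    (IsCoprime.prod_right fun j hj => ?_) (hw i hi) ?_
  · obtain ⟨hne, hj⟩ := Finset.mem_erase.mp hj
    exact hπ i hi j hj hne.symm
  · rw [← Finset.add_sum_erase s w hi] at hsum
    rw [eq_neg_of_add_eq_zero_left hsum, map_neg, map_sum, Finset.sum_eq_zero, neg_zero]
    intro j hj
    exact aeval_apply_eq_zero_of_dvd T (Finset.dvd_prod_of_mem π hj)
      (hw j (Finset.mem_of_mem_erase hj))

end Module

variable {E : Type*} [Field E] [Algebra F E] {x : E}
  {V : Type*} [AddCommGroup V] [Module E V] [Module F V] [IsScalarTower F E V]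

theorem aeval_apply_smul {γ : E →ₐ[F] E} {T : Module.End F V}
    (hT : ∀ (a : E) (u : V), T (a • u) = γ a • T u) {y : E} {a : F}
    (hy : γ y = algebraMap F E a * y) (p : F[X]) (w : V) :
    aeval T p (y • w) = y • aeval T (p.comp (C a * X)) w := by
  have hpow : ∀ n, (T ^ n) (y • w) = y • (a ^ n • (T ^ n) w) := by
    intro n
    induction n with
    | zero => simp
    | succ n ih =>
      rw [pow_succ', Module.End.mul_apply, ih, hT, hy, map_smul, Module.End.mul_apply, mul_comm,
        mul_smul, algebraMap_smul, pow_succ', mul_smul]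
  induction p using Polynomial.induction_on' with
  | add p q hp hq => simp [hp, hq, add_comp]
  | monomial n b =>
    have h : (monomial n b).comp (C a * X) = C (b * a ^ n) * X ^ n := by
      rw [← C_mul_X_pow_eq_monomial, mul_comp, C_comp, pow_comp, X_comp, mul_pow, C_mul, C_pow,
        mul_assoc]
    rw [h, aeval_monomial, aeval_mul_apply, aeval_C, aeval_X_pow, Module.End.mul_apply, hpow,
      Module.algebraMap_end_apply, Module.algebraMap_end_apply, smul_comm, mul_smul]

/-- Finitely many elements of `F(x)` have a common denominator. -/
theorem IsRatGenerator.exists_common_denominator (hx : IsRatGenerator F x) {κ : Type*}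
    (s : Finset κ) (a : κ → E) :
    ∃ (q : F[X]) (p : κ → F[X]), q ≠ 0 ∧ ∀ i ∈ s, a i * aeval x q = aeval x (p i) := by
  classical
  choose p q hq h using hx.exists_div
  refine ⟨∏ i ∈ s, q (a i), fun i => p (a i) * ∏ j ∈ s.erase i, q (a j),
    Finset.prod_ne_zero_iff.mpr fun i _ => hq _, fun i hi => ?_⟩
  rw [← Finset.mul_prod_erase s _ hi, map_mul, ← mul_assoc, h, map_mul]

theorem aeval_smul_eq_sum {p : F[X]} {n : ℕ} (hp : p.natDegree < n) (u : V) :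
    aeval x p • u = ∑ j ∈ Finset.range n, x ^ j • (p.coeff j • u) := by
  rw [aeval_eq_sum_range' hp, Finset.sum_smul]
  refine Finset.sum_congr rfl fun j _ => ?_
  rw [smul_assoc, smul_comm]

theorem map_pow_eigen {γ : E →ₐ[F] E} {c : F} (hγ : γ x = algebraMap F E c * x) (j : ℕ) :
    γ (x ^ j) = algebraMap F E (c ^ j) * x ^ j := by
  rw [map_pow, hγ, mul_pow, map_pow]

variable {γ : E →ₐ[F] E} {c : F} {T : Module.End F V}

theorem pow_ne_pow_of_infinite_order (hc0 : c ≠ 0) (hc : ∀ n : ℤ, c ^ n = 1 → n = 0) {i j : ℕ}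
    (hij : c ^ i = c ^ j) : i = j := by
  have := hc ((i : ℤ) - j) (by
    rw [zpow_sub₀ hc0, zpow_natCast, zpow_natCast, hij, div_self (pow_ne_zero _ hc0)])
  omega

/-- Linear independence over `F` implies linear independence over `F(x)` for vectors on which `T`
is unipotent: `T` has the only eigenvalue `c ^ j` on the multiples by `x ^ j` of such vectors. -/
theorem IsRatGenerator.linearIndependent_of_unipotent (hx : IsRatGenerator F x) (hc0 : c ≠ 0)
    (hc : ∀ n : ℤ, c ^ n = 1 → n = 0) (hγ : γ x = algebraMap F E c * x)
    (hT : ∀ (a : E) (u : V), T (a • u) = γ a • T u) {κ : Type*} {b : κ → V}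
    (hb : ∀ i, b i ∈ T.maxGenEigenspace 1) (hli : LinearIndependent F b) :
    LinearIndependent E b := by
  rw [linearIndependent_iff'] at hli ⊢
  intro s a hsum
  obtain ⟨q, p, hq, hp⟩ := hx.exists_common_denominator s a
  have hsum' : ∑ i ∈ s, aeval x (p i) • b i = 0 := by
    have h1 := congrArg (fun w => aeval x q • w) hsum
    simp only [smul_zero, Finset.smul_sum, smul_smul] at h1
    rw [← h1]
    exact Finset.sum_congr rfl fun i hi => by rw [← hp i hi, mul_comm]
  set n := s.sup (fun i => (p i).natDegree) + 1 with hn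
  have hdeg : ∀ i ∈ s, (p i).natDegree < n := fun i hi =>
    Nat.lt_succ_of_le (Finset.le_sup (f := fun i => (p i).natDegree) hi)
  have hsum2 : ∑ j ∈ Finset.range n, x ^ j • ∑ i ∈ s, (p i).coeff j • b i = 0 := by
    rw [← hsum', Finset.sum_congr rfl fun i hi => aeval_smul_eq_sum (hdeg i hi) (b i),
      Finset.sum_comm]
    exact Finset.sum_congr rfl fun j _ => Finset.smul_sum
  have hW : ∀ j, ∑ i ∈ s, (p i).coeff j • b i ∈ T.maxGenEigenspace 1 := fun j =>
    Submodule.sum_mem _ fun i _ => Submodule.smul_mem _ _ (hb i)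
  choose m hm using fun j => (Module.End.mem_maxGenEigenspace _ _ _).mp (hW j)
  have hzero := eq_zero_of_sum_eq_zero_of_isCoprime T (s := Finset.range n)
    (π := fun j => (X - C (c ^ j)) ^ m j) ?_ ?_ hsum2
  · intro i hi
    have hpi : p i = 0 := by
      ext j
      rw [coeff_zero]
      by_cases hj : j < n
      · have h1 := hzero j (Finset.mem_range.mpr hj)
        rw [smul_eq_zero_iff_right (pow_ne_zero _ hx.ne_zero)] at h1
        exact hli s _ h1 i hi
      · exact coeff_eq_zero_of_natDegree_lt ((hdeg i hi).trans_le (not_lt.mp hj))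
    have h2 := hp i hi
    rw [hpi, map_zero] at h2
    exact (mul_eq_zero.mp h2).resolve_right (mt hx.aeval_eq_zero.mp hq)
  · intro i _ j _ hij
    refine IsCoprime.pow (isCoprime_X_sub_C_of_isUnit_sub ?_)
    rw [isUnit_iff_ne_zero, sub_ne_zero]
    exact fun h => hij (pow_ne_pow_of_infinite_order hc0 hc h)
  · intro j _
    rw [aeval_apply_smul hT (map_pow_eigen hγ j)]
    have h1 : ((X - C (c ^ j)) ^ m j).comp (C (c ^ j) * X) =
        C ((c ^ j) ^ m j) * (X - C 1) ^ m j := by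
      simp only [pow_comp, sub_comp, X_comp, C_comp]
      simp only [map_pow]
      rw [← mul_pow]
      congr 1
      simp [mul_sub]
    have h2 : aeval T ((X - C 1) ^ m j : F[X]) = (T - (1 : F) • 1) ^ m j := by
      simp
    rw [h1, aeval_mul_apply, h2, hm, map_zero, smul_zero]

variable (K : Type*) [Field K] [Algebra F K]

/-- The element `μ` of an algebraic extension of `F` is, up to conjugation, an eigenvalue of `T`
on some finite-dimensional invariant subspace. -/
def IsSpectral (T : Module.End F V) (μ : K) : Prop :=
  ∃ v : V, v ≠ 0 ∧ aeval T (minpoly F μ) v = 0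

variable {K}

/-- If `p` annihilates a generating system of `V`, every spectral value is a root of `p`
up to a factor `c ^ j`. -/
theorem IsRatGenerator.exists_root_of_isSpectral [Algebra.IsAlgebraic F K]
    (hx : IsRatGenerator F x) (hc0 : c ≠ 0)
    (hc : ∀ n : ℤ, c ^ n = 1 → n = 0) (hγ : γ x = algebraMap F E c * x)
    (hT : ∀ (a : E) (u : V), T (a • u) = γ a • T u) {ι : Type*} [Fintype ι] {b : ι → V}
    (hb : Submodule.span E (Set.range b) = ⊤) {p : F[X]} (hp : ∀ i, aeval T p (b i) = 0)
    {μ : K} (hμ0 : μ ≠ 0) (hμ : IsSpectral K T μ) :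
    ∃ j : ℤ, aeval (algebraMap F K (c ^ j) * μ) p = 0 := by
  obtain ⟨v, hv0, hv⟩ := hμ
  set π := minpoly F μ with hπdef
  have hint : IsIntegral F μ := Algebra.IsIntegral.isIntegral μ
  have hirr : Irreducible π := minpoly.irreducible hint
  have hπ0 : π.coeff 0 ≠ 0 := minpoly.coeff_zero_ne_zero hint hμ0
  obtain ⟨f, hf⟩ := (Submodule.mem_span_range_iff_exists_fun E).mp
    (show v ∈ Submodule.span E (Set.range b) by rw [hb]; trivial)
  obtain ⟨d, g, hd0, hg⟩ := hx.exists_common_denominator Finset.univ f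
  have hdv : aeval x d • v = ∑ i, aeval x (g i) • b i := by
    rw [← hf, Finset.smul_sum]
    exact Finset.sum_congr rfl fun i hi => by rw [smul_smul, ← hg i hi, mul_comm]
  set n := Finset.univ.sup (fun i => (g i).natDegree) + 1 with hn
  have hdeg : ∀ i, (g i).natDegree < n := fun i =>
    Nat.lt_succ_of_le (Finset.le_sup (f := fun i => (g i).natDegree) (Finset.mem_univ i))
  -- `P` annihilates `x ^ j • b i` for all `j < n`: there `T` acts as `c ^ j • T` does on `b i`
  let P : F[X] := ∏ j ∈ Finset.range n, p.comp (C (c ^ j)⁻¹ * X)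
  have hP : aeval T P (aeval x d • v) = 0 := by
    rw [hdv, map_sum]
    refine Finset.sum_eq_zero fun i _ => ?_
    rw [aeval_smul_eq_sum (hdeg i), map_sum]
    refine Finset.sum_eq_zero fun j hj => ?_
    rw [aeval_apply_smul hT (map_pow_eigen hγ j), map_smul]
    have hdvd : p ∣ P.comp (C (c ^ j) * X) := by
      simp only [P, prod_comp]
      refine dvd_trans (dvd_of_eq ?_) (Finset.dvd_prod_of_mem _ hj)
      rw [comp_scale_comp_scale, inv_mul_cancel₀ (pow_ne_zero _ hc0)]
      simp
    rw [aeval_apply_eq_zero_of_dvd T hdvd (hp i), smul_zero, smul_zero]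
  rw [aeval_smul_eq_sum (Nat.lt_succ_self d.natDegree), map_sum] at hP
  have hzero := eq_zero_of_sum_eq_zero_of_isCoprime T
    (π := fun j => π.comp (C (c ^ j)⁻¹ * X)) ?_ ?_ hP
  · have h1 := hzero d.natDegree (by simp)
    rw [aeval_apply_smul hT (map_pow_eigen hγ _), map_smul,
      smul_eq_zero_iff_right (pow_ne_zero _ hx.ne_zero),
      smul_eq_zero_iff_right (show d.coeff d.natDegree ≠ 0 from leadingCoeff_ne_zero.mpr hd0)] at h1
    have h2 : π ∣ P.comp (C (c ^ d.natDegree) * X) :=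
      (hirr.isCoprime_or_dvd _).resolve_left fun hco => hv0 (eq_zero_of_isCoprime T hco hv h1)
    have h3 : aeval μ (P.comp (C (c ^ d.natDegree) * X)) = 0 := by
      obtain ⟨r, hr⟩ := h2
      rw [hr, map_mul, hπdef, minpoly.aeval, zero_mul]
    rw [eval_scale, map_prod, Finset.prod_eq_zero_iff] at h3
    obtain ⟨i, -, hi⟩ := h3
    refine ⟨d.natDegree - i, ?_⟩
    rw [eval_scale, ← mul_assoc, ← map_mul] at hi
    rw [← hi, zpow_sub₀ hc0, zpow_natCast, zpow_natCast, div_eq_inv_mul]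
  · intro i _ j _ hij
    refine isCoprime_comp_scale_of_irreducible hirr hπ0
      (inv_ne_zero (pow_ne_zero _ hc0)) fun m hm h => hij ?_
    rw [inv_pow, inv_pow, inv_inj, ← pow_mul, ← pow_mul] at h
    exact Nat.eq_of_mul_eq_mul_right (Nat.pos_of_ne_zero hm)
      (pow_ne_pow_of_infinite_order hc0 hc h)
  · intro j _
    rw [aeval_apply_smul hT (map_pow_eigen hγ j), aeval_apply_smul hT (map_pow_eigen hγ j),
      comp_scale_comp_scale, inv_mul_cancel₀ (pow_ne_zero _ hc0)]
    have h1 : π.comp (C 1 * X) = π := by simp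
    rw [h1, map_smul, map_smul, ← aeval_mul_apply, mul_comm, aeval_mul_apply, hv, map_zero,
      smul_zero, smul_zero]

/-- An operator `Θ` with `T Θ = Θ T ^ q` intertwines `p(T)` with `p(T ^ q)`. -/
theorem aeval_apply_of_intertwines {V : Type*} [AddCommGroup V] [Module F V]
    {T Θ : Module.End F V} {q : ℕ} (hΘ : ∀ u, T (Θ u) = Θ ((T ^ q) u)) (p : F[X]) (u : V) :
    aeval T p (Θ u) = Θ (aeval T (expand F q p) u) := by
  have hpow : ∀ n u, (T ^ n) (Θ u) = Θ (((T ^ q) ^ n) u) := by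
    intro n
    induction n with
    | zero => simp
    | succ n ih =>
      intro u
      rw [pow_succ', Module.End.mul_apply, ih, hΘ, pow_succ', Module.End.mul_apply]
  rw [expand_aeval]
  induction p using Polynomial.induction_on' with
  | add p r hp hr => simp [hp, hr]
  | monomial n b => simp [aeval_monomial, hpow]

/-- Spectral values are stable under powers realized by operators. -/
theorem IsSpectral.pow {V : Type*} [AddCommGroup V] [Module F V] {T : Module.End F V} {μ : K}
    (hμ : IsSpectral K T μ) {q : ℕ}
    {Θ : Module.End F V} (hΘ : ∀ u, T (Θ u) = Θ ((T ^ q) u)) (hinj : Function.Injective Θ) :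
    IsSpectral K T (μ ^ q) := by
  obtain ⟨v, hv0, hv⟩ := hμ
  refine ⟨Θ v, fun h => hv0 (hinj (by rw [h, map_zero])), ?_⟩
  rw [aeval_apply_of_intertwines hΘ, aeval_apply_eq_zero_of_dvd T (minpoly.dvd F μ ?_) hv, map_zero]
  rw [expand_aeval, minpoly.aeval]

theorem IsSpectral.ne_zero {V : Type*} [AddCommGroup V] [Module F V] {T : Module.End F V}
    (hT : Function.Injective T) {μ : K} (hμ : IsSpectral K T μ) : μ ≠ 0 := by
  rintro rfl
  obtain ⟨v, hv0, hv⟩ := hμ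
  rw [minpoly.zero, aeval_X] at hv
  exact hv0 (hT (by rw [hv, map_zero]))

/-- If all roots of `p` have powers in `F` with a common exponent, given by values of `f`,
then `p` divides a product of binomials. -/
theorem dvd_expand_prod [IsAlgClosed K] {p : F[X]} (hp : p ≠ 0) {M : ℕ} {f : K → F}
    (hf : ∀ μ ∈ p.aroots K, μ ^ M = algebraMap F K (f μ)) :
    p ∣ expand F M ((p.aroots K).map fun μ => X - C (f μ)).prod := by
  rw [← map_dvd_map' (algebraMap F K)]
  have h1 : (p.map (algebraMap F K)) = C (algebraMap F K p.leadingCoeff) *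
      ((p.aroots K).map fun μ => X - C μ).prod := by
    conv_lhs => rw [(IsAlgClosed.splits (p.map (algebraMap F K))).eq_prod_roots]
    rw [leadingCoeff_map]
  have h2 : (expand F M ((p.aroots K).map fun μ => X - C (f μ)).prod).map (algebraMap F K) =
      ((p.aroots K).map fun μ => X ^ M - C (μ ^ M)).prod := by
    rw [map_multiset_prod, Polynomial.map_multiset_prod, Multiset.map_map, Multiset.map_map]
    refine congrArg _ (Multiset.map_congr rfl fun μ hμ => ?_)
    simp [hf μ hμ]
  have hu : IsUnit (C (algebraMap F K p.leadingCoeff)) := by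
    rw [isUnit_C, isUnit_iff_ne_zero]
    simpa using hp
  rw [h1, h2, hu.mul_left_dvd]
  refine Multiset.prod_dvd_prod_of_dvd _ _ fun μ _ => ?_
  rw [C_pow]
  exact sub_dvd_pow_sub_pow _ _ _

/-- A submodule containing the kernels of all powers of `T - a`, for `a` in a multiset `S`,
contains the kernel of the corresponding product. -/
theorem mem_of_aeval_prod_eq_zero {V : Type*} [AddCommGroup V] [Module F V] {T : Module.End F V}
    {U : Submodule F V} {S : Multiset F}
    (hU : ∀ a ∈ S, ∀ (m : ℕ) (w : V), aeval T ((X - C a) ^ m) w = 0 → w ∈ U) {w : V}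
    (hw : aeval T (S.map fun a => X - C a).prod w = 0) : w ∈ U := by
  classical
  rw [Finset.prod_multiset_map_count] at hw
  have key : ∀ s : Finset F, s ⊆ S.toFinset →
      LinearMap.ker (aeval T (∏ a ∈ s, (X - C a) ^ S.count a)) ≤ U := by
    intro s
    induction s using Finset.induction_on with
    | empty =>
      intro _ w hw
      have : w = 0 := by simpa using hw
      rw [this]
      exact U.zero_mem
    | insert a s has ih =>
      intro hs
      rw [Finset.prod_insert has, ← sup_ker_aeval_eq_ker_aeval_mul_of_coprime]
      · refine sup_le (fun w hw => ?_) (ih fun i hi => hs (Finset.mem_insert_of_mem hi))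
        exact hU a (Multiset.mem_toFinset.mp (hs (Finset.mem_insert_self a s))) _ w hw
      · refine IsCoprime.prod_right fun b hb => IsCoprime.pow (isCoprime_X_sub_C_of_isUnit_sub ?_)
        rw [isUnit_iff_ne_zero, sub_ne_zero]
        rintro rfl
        exact has hb
  exact key _ subset_rfl hw

/-- If the vectors annihilated by polynomials in `T` span `V`, then so do those on which `T` is
unipotent. The spectral values of `T` have only finitely many classes modulo powers of `c`, and
these are stable under squaring; hence some power `λ ^ M` of each of them is a power of `c`. Passing
from vectors `u` to `Θ_M u` replaces `λ` by `λ ^ M`, and factors `x ^ n` reduce the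
remaining spectral values `c ^ n` to `1`. -/
theorem IsRatGenerator.span_unipotent_eq_top [FiniteDimensional E V]
    (hx : IsRatGenerator F x) (hc0 : c ≠ 0)
    (hc : ∀ n : ℤ, c ^ n = 1 → n = 0) (hγ : γ x = algebraMap F E c * x)
    (hT : ∀ (a : E) (u : V), T (a • u) = γ a • T u) (hTinj : Function.Injective T)
    (hann : Submodule.span E {u : V | ∃ p : F[X], p ≠ 0 ∧ aeval T p u = 0} = ⊤)
    (hpow : ∀ q : ℕ, 0 < q → ∃ (θ : E →ₐ[F] E) (Θ : Module.End F V),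
      (∀ (a : E) (u : V), Θ (a • u) = θ a • Θ u) ∧ (∀ u, T (Θ u) = Θ ((T ^ q) u)) ∧
      Function.Injective Θ ∧ Submodule.span E (Set.range Θ) = ⊤) :
    Submodule.span E (T.maxGenEigenspace 1 : Set V) = ⊤ := by
  classical
  let K := AlgebraicClosure F
  -- a finite generating system with a common annihilating polynomial `p`; its degree is taken
  -- minimal, so that all its roots are spectral values
  obtain ⟨s, hsub, hspan⟩ : ∃ s : Finset V, (∀ u ∈ s, ∃ p : F[X], p ≠ 0 ∧ aeval T p u = 0) ∧
      Submodule.span E (s : Set V) = ⊤ := by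
    obtain ⟨s, hs, hs'⟩ := (Submodule.fg_span_iff_fg_span_finset_subset _).mp
      (hann ▸ (Module.Finite.fg_top : (⊤ : Submodule E V).FG))
    exact ⟨s, fun u hu => hs hu, by rw [← hs', hann]⟩
  have hex : ∃ d : ℕ, ∃ p : F[X], p ≠ 0 ∧ p.natDegree = d ∧ ∀ u ∈ s, aeval T p u = 0 := by
    choose! p hp0 hp using hsub
    exact ⟨_, ∏ u ∈ s, p u, Finset.prod_ne_zero_iff.mpr hp0, rfl, fun u hu =>
      aeval_apply_eq_zero_of_dvd T (Finset.dvd_prod_of_mem p hu) (hp u hu)⟩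
  obtain ⟨p, hp0, hpd, hp⟩ := Nat.find_spec hex
  have hroots : ∀ μ : K, aeval μ p = 0 → IsSpectral K T μ := by
    intro μ hμ
    obtain ⟨r, hr⟩ := minpoly.dvd F μ hμ
    have hr0 : r ≠ 0 := by
      rintro rfl
      exact hp0 (by rw [hr, mul_zero])
    have hm0 : minpoly F μ ≠ 0 := fun h => hp0 (by rw [hr, h, zero_mul])
    have hlt : r.natDegree < Nat.find hex := by
      rw [← hpd, hr, natDegree_mul hm0 hr0]
      have := minpoly.natDegree_pos (Algebra.IsIntegral.isIntegral (R := F) μ)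
      omega
    have hmin := Nat.find_min hex hlt
    push Not at hmin
    obtain ⟨u, hu, hne⟩ := hmin r hr0 rfl
    exact ⟨_, hne, by rw [← aeval_mul_apply, ← hr, hp u hu]⟩
  -- each spectral value has a power which is a power of `c`
  have htors : ∀ μ : K, IsSpectral K T μ → ∃ M : ℕ, 0 < M ∧ ∃ n : ℤ,
      μ ^ M = algebraMap F K (c ^ n) := by
    intro μ hμ
    have hμ0 := hμ.ne_zero hTinj
    have hμi : ∀ i : ℕ, ∃ j : ℤ, algebraMap F K (c ^ j) * μ ^ (2 ^ i) ∈ (p.aroots K).toFinset := by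
      intro i
      obtain ⟨θ, Θ, -, hΘ, hinj, -⟩ := hpow (2 ^ i) (by positivity)
      obtain ⟨j, hj⟩ := hx.exists_root_of_isSpectral hc0 hc hγ hT (b := ((↑) : s → V))
        (by simpa using hspan) (fun u => hp u u.2) (pow_ne_zero _ hμ0) (hμ.pow hΘ hinj)
      exact ⟨j, by simpa [hp0] using hj⟩
    choose j hj using hμi
    obtain ⟨a, b, hab, h⟩ := Finite.exists_ne_map_eq_of_infinite
      (fun i => (⟨_, hj i⟩ : {α : K // α ∈ (p.aroots K).toFinset}))
    wlog hlt : a < b generalizing a b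
    · exact this b a hab.symm h.symm (lt_of_le_of_ne (not_lt.mp hlt) hab.symm)
    have h' := congrArg Subtype.val h
    simp only at h'
    have hlt2 : 2 ^ a < 2 ^ b := Nat.pow_lt_pow_right (by norm_num) hlt
    refine ⟨2 ^ b - 2 ^ a, Nat.sub_pos_of_lt hlt2, j a - j b, ?_⟩
    have hcK : ∀ n : ℤ, algebraMap F K (c ^ n) ≠ 0 := fun n => by
      exact (_root_.map_ne_zero _).mpr (zpow_ne_zero n hc0)
    rw [zpow_sub₀ hc0, map_div₀, eq_div_iff (hcK _)]
    apply mul_right_cancel₀ (pow_ne_zero (2 ^ a) hμ0)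
    rw [h', mul_right_comm, ← pow_add, Nat.sub_add_cancel hlt2.le, mul_comm]
  obtain ⟨M, hM0, f, hf⟩ : ∃ M : ℕ, 0 < M ∧ ∃ n : K → ℤ, ∀ μ ∈ p.aroots K,
      μ ^ M = algebraMap F K (c ^ n μ) := by
    have h1 : ∀ μ ∈ p.aroots K, ∃ M : ℕ, 0 < M ∧ ∃ n : ℤ, μ ^ M = algebraMap F K (c ^ n) :=
      fun μ hμ => htors μ (hroots μ (by simpa [hp0] using hμ))
    choose! m hm n hn using h1
    refine ⟨∏ μ ∈ (p.aroots K).toFinset, m μ,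
      Finset.prod_pos fun μ hμ => hm μ (Multiset.mem_toFinset.mp hμ),
      fun μ => n μ * (∏ ν ∈ (p.aroots K).toFinset.erase μ, m ν : ℕ), fun μ hμ => ?_⟩
    rw [← Finset.mul_prod_erase _ _ (Multiset.mem_toFinset.mpr hμ), pow_mul, hn μ hμ, ← map_pow,
      zpow_mul, zpow_natCast]
  obtain ⟨θ, Θ, hΘs, hΘ, -, hΘspan⟩ := hpow M hM0
  have hmem : ∀ u ∈ s, Θ u ∈ Submodule.span E (T.maxGenEigenspace 1 : Set V) := by
    intro u hu
    have hdvd := dvd_expand_prod (K := K) hp0 hf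
    have h1 : aeval T ((p.aroots K).map fun μ => X - C (c ^ f μ)).prod (Θ u) = 0 := by
      rw [aeval_apply_of_intertwines hΘ, aeval_apply_eq_zero_of_dvd T hdvd (hp u hu), map_zero]
    have h2 : ((p.aroots K).map fun μ => X - C (c ^ f μ)) =
        ((p.aroots K).map fun μ => c ^ f μ).map fun a => X - C a := by
      rw [Multiset.map_map]
      rfl
    rw [h2] at h1
    refine mem_of_aeval_prod_eq_zero
      (U := (Submodule.span E (T.maxGenEigenspace 1 : Set V)).restrictScalars F) ?_ h1
    intro a ha m w hw
    obtain ⟨μ, -, rfl⟩ := Multiset.mem_map.mp ha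
    set n := f μ
    -- multiplication by `x ^ (-n)` turns the eigenvalue `c ^ n` into `1`
    have hy : γ (x ^ (-n)) = algebraMap F E (c ^ (-n)) * x ^ (-n) := by
      rw [map_zpow₀, hγ, mul_zpow, map_zpow₀]
    have hW : x ^ (-n) • w ∈ T.maxGenEigenspace 1 := by
      rw [Module.End.mem_maxGenEigenspace]
      refine ⟨m, ?_⟩
      have e1 : (T - (1 : F) • 1) ^ m = aeval T ((X - C 1) ^ m : F[X]) := by simp
      have e2 : ((X - C 1) ^ m : F[X]).comp (C (c ^ (-n)) * X) =
          C ((c ^ (-n)) ^ m) * (X - C (c ^ n)) ^ m := by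
        rw [pow_comp, sub_comp, X_comp, C_comp, C_pow, ← mul_pow, mul_sub, ← C_mul,
          zpow_neg, inv_mul_cancel₀ (zpow_ne_zero n hc0)]
      rw [e1, aeval_apply_smul hT hy, e2, aeval_mul_apply, hw, map_zero, smul_zero]
    have h3 := Submodule.smul_mem _ (x ^ n) (Submodule.subset_span (R := E) hW)
    rwa [smul_smul, ← zpow_add₀ hx.ne_zero, add_neg_cancel, zpow_zero, one_smul] at h3
  rw [eq_top_iff, ← hΘspan, Submodule.span_le]
  rintro _ ⟨u, rfl⟩
  have hu : u ∈ Submodule.span E (s : Set V) := by rw [hspan]; trivial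
  induction hu using Submodule.span_induction with
  | mem u hu => exact hmem u hu
  | zero => rw [map_zero]; exact Submodule.zero_mem _
  | add u w _ _ hu hw => rw [map_add]; exact Submodule.add_mem _ hu hw
  | smul a u _ hu => rw [hΘs]; exact Submodule.smul_mem _ _ hu

end Spectrum

/-! ### Semi-linear representations of the semigroup of monomial endomorphisms -/

namespace MonomialEnd

variable {k : Type*} [Field k]

/-- The endomorphisms `x ↦ c x`. -/
def scaling (k : Type*) [Field k] : kˣ →* MonomialEnd k where
  toFun c := ⟨1, c⟩
  map_one' := rfl
  map_mul' a b := by ext <;> simp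

/-- The endomorphism `x ↦ x ^ q`, for a positive integer `q`. -/
def power (k : Type*) [Field k] (q : ℕ) (hq : 0 < q) : MonomialEnd k :=
  ⟨⟨q, mem_nonZeroDivisors_of_ne_zero (by omega)⟩, 1⟩

@[simp] theorem scaling_expo (c : kˣ) : (scaling k c).expo = 1 := rfl

@[simp] theorem scaling_coef (c : kˣ) : (scaling k c).coef = c := rfl

@[simp] theorem power_expo (q : ℕ) (hq : 0 < q) : ((power k q hq).expo : ℤ) = q := rfl

theorem scaling_mul (c : kˣ) (s : MonomialEnd k) :
    scaling k c * s = s * scaling k (c ^ (s.expo : ℤ)) := by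
  ext1
  · simp
  · simp [mul_comm]

theorem scaling_mul_power (c : kˣ) (q : ℕ) (hq : 0 < q) :
    scaling k c * power k q hq = power k q hq * scaling k c ^ q := by
  rw [scaling_mul, power_expo, zpow_natCast, map_pow]

end MonomialEnd

namespace SemilinearRep

variable {k : Type*} {F : Type*} {G : Type*} [Field k] [Field F] [Algebra k F] [Monoid G]
  {φ : G →* (F →ₐ[k] F)} {V : Type*} [AddCommGroup V] [Module F V]

theorem act_mul_apply (ρ : SemilinearRep φ V) (σ τ : G) (u : V) :
    ρ.act (σ * τ) u = ρ.act σ (ρ.act τ u) := by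
  rw [map_mul]
  rfl

theorem act_one_apply (ρ : SemilinearRep φ V) (u : V) : ρ.act 1 u = u := by
  rw [map_one]
  rfl

/-- The image of a generating set under an operator of a non-degenerate semi-linear representation
is a generating set. -/
theorem NonDegenerate.span_image {ρ : SemilinearRep φ V} (hρ : ρ.NonDegenerate) (σ : G) {s : Set V}
    (hs : Submodule.span F s = ⊤) : Submodule.span F (ρ.act σ '' s) = ⊤ := by
  rw [eq_top_iff, ← hρ σ, Submodule.span_le]
  rintro _ ⟨u, rfl⟩
  have hu : u ∈ Submodule.span F s := by rw [hs]; trivial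
  induction hu using Submodule.span_induction with
  | mem u hu => exact Submodule.subset_span ⟨u, hu, rfl⟩
  | zero => rw [map_zero]; exact Submodule.zero_mem _
  | add u w _ _ hu hw => rw [map_add]; exact Submodule.add_mem _ hu hw
  | smul a u _ hu => rw [ρ.act_smul]; exact Submodule.smul_mem _ _ hu

theorem NonDegenerate.linearIndependent {ρ : SemilinearRep φ V} (hρ : ρ.NonDegenerate) (σ : G)
    {ι : Type*} [Finite ι] (b : Module.Basis ι F V) :
    LinearIndependent F fun i => ρ.act σ (b i) := by
  have := Fintype.ofFinite ι
  refine linearIndependent_of_top_le_span_of_card_eq_finrank ?_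
    (Module.finrank_eq_card_basis b).symm
  have h := hρ.span_image σ b.span_eq
  rw [← Set.range_comp] at h
  exact h.ge

theorem NonDegenerate.injective {ρ : SemilinearRep φ V} [FiniteDimensional F V]
    (hρ : ρ.NonDegenerate) (σ : G) : Function.Injective (ρ.act σ) := by
  rw [injective_iff_map_eq_zero]
  intro u hu
  let b := Module.finBasis F V
  rw [← b.sum_repr u, map_sum] at hu
  simp only [ρ.act_smul] at hu
  have h := Fintype.linearIndependent_iff.mp (hρ.linearIndependent σ b) _ hu
  rw [← b.sum_repr u]
  exact Finset.sum_eq_zero fun i _ => by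
    rw [(map_eq_zero_iff _ (φ σ).injective).mp (h i), zero_smul]

variable [Module k V] [IsScalarTower k F V]

/-- The operators of a semi-linear representation are linear over the field of constants. -/
def toEnd (ρ : SemilinearRep φ V) (σ : G) : Module.End k V where
  toFun := ρ.act σ
  map_add' := map_add _
  map_smul' a u := by
    rw [← algebraMap_smul F a u, ρ.act_smul, AlgHom.commutes, algebraMap_smul, RingHom.id_apply]

@[simp] theorem toEnd_apply (ρ : SemilinearRep φ V) (σ : G) (u : V) : ρ.toEnd σ u = ρ.act σ u := rfl

theorem toEnd_pow_apply (ρ : SemilinearRep φ V) (σ : G) (q : ℕ) (u : V) :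
    (ρ.toEnd σ ^ q) u = ρ.act (σ ^ q) u := by
  induction q with
  | zero => simp
  | succ q ih => rw [pow_succ', Module.End.mul_apply, ih, pow_succ', act_mul_apply, toEnd_apply]

theorem toEnd_sub_one_pow_apply (ρ : SemilinearRep φ V) (σ : G) (i : ℕ) (u : V) :
    ((ρ.toEnd σ - (1 : k) • 1) ^ i) u = ((ρ.act σ - 1) ^ i) u := by
  induction i with
  | zero => rfl
  | succ i ih =>
    rw [pow_succ', Module.End.mul_apply, ih, pow_succ']
    simp
    rfl

end SemilinearRep

/-- The unit `2` of a field of characteristic zero; it has infinite order. -/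
def unitTwo (k : Type*) [Field k] [CharZero k] : kˣ := Units.mk0 2 two_ne_zero

theorem algebraMap_unitTwo (k F : Type*) [Field k] [CharZero k] [Field F] [Algebra k F] :
    algebraMap k F (unitTwo k) = 2 := map_ofNat _ 2

theorem zpow_two_eq_one {F : Type*} [Field F] [CharZero F] {n : ℤ} (h : (2 : F) ^ n = 1) :
    n = 0 := by
  have h1 : ((2 : ℚ) ^ n : ℚ) = 1 := by
    have : ((2 ^ n : ℚ) : F) = ((1 : ℚ) : F) := by simpa using h
    exact_mod_cast this
  exact (zpow_eq_one_iff_right₀ (by norm_num) (by norm_num)).mp h1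

section OneVariable

open Module

variable {k F E : Type*} [Field k] [CharZero k] [Field F] [Field E] [Algebra k F] [Algebra F E]
  [Algebra k E] [IsScalarTower k F E] {x : E} {V : Type*} [AddCommGroup V] [Module E V]
  [Module F V] [IsScalarTower F E V] {φ : MonomialEnd k →* (E →ₐ[F] E)}

omit [CharZero k] in
theorem map_scaling (hφ : ∀ s, φ s x = algebraMap k E s.coef * x ^ (s.expo : ℤ)) (c : kˣ) :
    φ (MonomialEnd.scaling k c) x = algebraMap F E (algebraMap k F c) * x := by
  rw [hφ, ← IsScalarTower.algebraMap_apply]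
  simp

/-- A linearly independent system over `F` of vectors on which `x ↦ 2 x` acts unipotently is
linearly independent over `F(x)`. -/
theorem IsRatGenerator.linearIndependent_of_rep (hx : IsRatGenerator F x)
    (hφ : ∀ s, φ s x = algebraMap k E s.coef * x ^ (s.expo : ℤ)) (ρ : SemilinearRep φ V)
    {κ : Type*} {b : κ → V}
    (hb : ∀ i, b i ∈ (ρ.toEnd (MonomialEnd.scaling k (unitTwo k))).maxGenEigenspace 1)
    (hli : LinearIndependent F b) : LinearIndependent E b := by
  have : CharZero F := charZero_of_injective_algebraMap (algebraMap k F).injective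
  refine hx.linearIndependent_of_unipotent (c := algebraMap k F (unitTwo k)) ?_ ?_
    (map_scaling hφ _) (ρ.act_smul _) hb hli
  · simp
  · intro n hn
    exact zpow_two_eq_one (F := F) (by rwa [algebraMap_unitTwo] at hn)

/-- The vectors on which `x ↦ 2 x` acts unipotently span a non-degenerate semi-linear
representation. -/
theorem IsRatGenerator.span_eq_top_of_rep [FiniteDimensional E V] {l : ℕ} (hl : 2 ≤ l)
    (hroots : ∀ m : ℕ, ∃ ζ : k, IsPrimitiveRoot ζ (l ^ m)) (hx : IsRatGenerator F x)
    (hφ : ∀ s, φ s x = algebraMap k E s.coef * x ^ (s.expo : ℤ)) (ρ : SemilinearRep φ V)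
    (hρ : ρ.NonDegenerate) :
    Submodule.span E
      ((ρ.toEnd (MonomialEnd.scaling k (unitTwo k))).maxGenEigenspace 1 : Set V) = ⊤ := by
  have : CharZero F := charZero_of_injective_algebraMap (algebraMap k F).injective
  have hc0 : algebraMap k F (unitTwo k) ≠ 0 := by simp
  have hc : ∀ n : ℤ, algebraMap k F (unitTwo k) ^ n = 1 → n = 0 := by
    intro n hn
    exact zpow_two_eq_one (F := F) (by rwa [algebraMap_unitTwo] at hn)
  refine hx.span_unipotent_eq_top hc0 hc (map_scaling hφ _) (ρ.act_smul _) (hρ.injective _)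
    (hx.span_annihilated_eq_top hc0 hc (map_scaling hφ _) (ρ.act_smul _) ?_) ?_
  · intro B
    obtain ⟨ζ, hζ⟩ := hroots B
    have hM : 0 < l ^ B := by positivity
    have hζu : IsUnit ζ := hζ.isUnit hM.ne'
    refine ⟨l ^ B, algebraMap k F ζ, φ (MonomialEnd.scaling k hζu.unit),
      ρ.toEnd (MonomialEnd.scaling k hζu.unit), (Nat.lt_pow_self (by omega)).le,
      hζ.map_of_injective (algebraMap k F).injective, map_scaling hφ _, ρ.act_smul _, ?_, ?_⟩
    · intro u
      simp only [SemilinearRep.toEnd_apply, ← SemilinearRep.act_mul_apply, ← map_mul, mul_comm]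
    · -- the image of `x ↦ x ^ M` is fixed by `x ↦ ζ x`
      rw [eq_top_iff, ← hρ (MonomialEnd.power k (l ^ B) hM), Submodule.span_le]
      rintro _ ⟨u, rfl⟩
      apply Submodule.subset_span
      change ρ.act _ (ρ.act _ u) = _
      have h1 : hζu.unit ^ (l ^ B) = 1 := Units.ext (by simpa using hζ.pow_eq_one)
      rw [← SemilinearRep.act_mul_apply, MonomialEnd.scaling_mul_power, ← map_pow, h1, map_one,
        mul_one]
  · intro q hq
    refine ⟨φ (MonomialEnd.power k q hq), ρ.toEnd (MonomialEnd.power k q hq), ρ.act_smul _,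
      fun u => ?_, hρ.injective _, hρ _⟩
    rw [SemilinearRep.toEnd_pow_apply]
    simp only [SemilinearRep.toEnd_apply, ← SemilinearRep.act_mul_apply]
    rw [MonomialEnd.scaling_mul_power]

end OneVariable

/-! ### Descent to the constants, one variable at a time -/

section Descent

open Module

/-- The vector `v` is killed by a power of `A - 1`. -/
def IsUnipotentAt {V : Type*} [AddCommGroup V] (A : AddMonoid.End V) (v : V) : Prop :=
  ∃ i : ℕ, ((A - 1) ^ i) v = 0

theorem SemilinearRep.mem_maxGenEigenspace_iff {k F G V : Type*} [Field k] [Field F] [Algebra k F]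
    [Monoid G] {φ : G →* (F →ₐ[k] F)} [AddCommGroup V] [Module F V] [Module k V]
    [IsScalarTower k F V] (ρ : SemilinearRep φ V) (σ : G) (v : V) :
    v ∈ (ρ.toEnd σ).maxGenEigenspace 1 ↔ IsUnipotentAt (ρ.act σ) v := by
  simp only [Module.End.mem_maxGenEigenspace, ρ.toEnd_sub_one_pow_apply, IsUnipotentAt]

theorem IsUnipotentAt.map_of_commute {V : Type*} [AddCommGroup V] {A B : AddMonoid.End V}
    (h : Commute A B) {v : V} (hv : IsUnipotentAt A v) : IsUnipotentAt A (B v) := by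
  obtain ⟨i, hi⟩ := hv
  refine ⟨i, ?_⟩
  have h1 : Commute ((A - 1) ^ i) B := (h.sub_left (Commute.one_left B)).pow_left i
  have h2 := DFunLike.congr_fun h1.eq v
  change ((A - 1) ^ i) (B v) = B (((A - 1) ^ i) v) at h2
  rw [h2, hi, map_zero]

/-- Extension of a family of length `n` by the neutral element. -/
def snocOne (G : Type*) [Monoid G] (n : ℕ) : (Fin n → G) →* (Fin (n + 1) → G) where
  toFun s := Fin.snoc (α := fun _ => G) s 1
  map_one' := by
    ext j
    refine Fin.lastCases ?_ (fun j => ?_) j <;> simp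
  map_mul' s t := by
    ext j
    refine Fin.lastCases ?_ (fun j => ?_) j <;> simp

@[simp] theorem snocOne_castSucc {G : Type*} [Monoid G] {n : ℕ} (s : Fin n → G) (j : Fin n) :
    snocOne G n s j.castSucc = s j := by simp [snocOne]

@[simp] theorem snocOne_last {G : Type*} [Monoid G] {n : ℕ} (s : Fin n → G) :
    snocOne G n s (Fin.last n) = 1 := by simp [snocOne]

theorem snocOne_mulSingle {G : Type*} [Monoid G] {n : ℕ} (j : Fin n) (g : G) :
    snocOne G n (Pi.mulSingle j g) = Pi.mulSingle j.castSucc g := by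
  ext i
  refine Fin.lastCases ?_ (fun i => ?_) i
  · rw [snocOne_last, Pi.mulSingle_eq_of_ne (Fin.castSucc_lt_last j).ne']
  · rw [snocOne_castSucc, Pi.mulSingle_apply, Pi.mulSingle_apply]
    simp

theorem commute_snocOne {G : Type*} [Monoid G] {n : ℕ} (s : Fin n → G) (g : G) :
    Commute (Pi.mulSingle (Fin.last n) g : Fin (n + 1) → G) (snocOne G n s) := by
  ext i
  refine Fin.lastCases ?_ (fun i => ?_) i
  · simp
  · simp

section Field

variable {k E : Type*} [Field k] [Field E] [Algebra k E] {n : ℕ} {x : Fin (n + 1) → E}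

/-- The field `k(x_1, …, x_n)` generated by all but the last variable. -/
abbrev initField (k : Type*) {E : Type*} [Field k] [Field E] [Algebra k E] {n : ℕ}
    (x : Fin (n + 1) → E) : IntermediateField k E :=
  IntermediateField.adjoin k (Set.range fun j : Fin n => x j.castSucc)

theorem isRatGenerator_last (hx : AlgebraicIndependent k x)
    (hgen : IntermediateField.adjoin k (Set.range x) = ⊤) :
    IsRatGenerator (initField k x) (x (Fin.last n)) where
  transcendental h := by
    have himg : x '' {Fin.last n}ᶜ = Set.range fun j : Fin n => x j.castSucc := by
      ext a
      constructor
      · rintro ⟨j, hj, rfl⟩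
        obtain ⟨i, rfl⟩ := Fin.exists_castSucc_eq.mpr hj
        exact ⟨i, rfl⟩
      · rintro ⟨i, rfl⟩
        exact ⟨_, (Fin.castSucc_lt_last i).ne, rfl⟩
    have h1 := hx.transcendental_adjoin (i := Fin.last n) (s := {Fin.last n}ᶜ) (by simp)
    rw [himg] at h1
    open scoped IntermediateField.algebraAdjoinAdjoin in
    exact h1 ((IsFractionRing.isAlgebraic_iff _ (initField k x) E).mpr h)
  exists_div a := by
    have htop : a ∈ IntermediateField.adjoin (initField k x) {x (Fin.last n)} := by
      rw [← IntermediateField.mem_restrictScalars k, IntermediateField.adjoin_adjoin_left]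
      have : (Set.range fun j : Fin n => x j.castSucc) ∪ {x (Fin.last n)} = Set.range x := by
        ext a
        constructor
        · rintro (⟨j, rfl⟩ | rfl)
          · exact ⟨_, rfl⟩
          · exact ⟨_, rfl⟩
        · rintro ⟨j, rfl⟩
          refine Fin.lastCases ?_ (fun j => ?_) j
          · exact Or.inr rfl
          · exact Or.inl ⟨j, rfl⟩
      rw [this, hgen]
      trivial
    obtain ⟨r, s, h⟩ := (IntermediateField.mem_adjoin_simple_iff _ _).mp htop
    by_cases hs : aeval (x (Fin.last n)) s = 0
    · exact ⟨0, 1, one_ne_zero, by rw [h, hs]; simp⟩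
    · refine ⟨r, s, ?_, by rw [h, div_mul_cancel₀ _ hs]⟩
      rintro rfl
      simp at hs

variable {φ : (Fin (n + 1) → MonomialEnd k) →* (E →ₐ[k] E)}
  (hφ : ∀ s j, φ s (x j) = algebraMap k E (s j).coef * x j ^ ((s j).expo : ℤ))
include hφ

theorem map_mulSingle_last_eq (s : MonomialEnd k) (y : initField k x) :
    φ (Pi.mulSingle (Fin.last n) s) y = y := by
  obtain ⟨y, hy⟩ := y
  change φ (Pi.mulSingle (Fin.last n) s) y = y
  induction hy using IntermediateField.adjoin_induction with
  | mem y hy =>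
    obtain ⟨j, rfl⟩ := hy
    simp [hφ]
  | algebraMap a => exact AlgHom.commutes _ a
  | add y z _ _ hy hz => rw [map_add, hy, hz]
  | inv y _ hy => rw [map_inv₀, hy]
  | mul y z _ _ hy hz => rw [map_mul, hy, hz]

theorem map_snocOne_mem (s : Fin n → MonomialEnd k) (y : initField k x) :
    φ (snocOne _ n s) y ∈ initField k x := by
  obtain ⟨y, hy⟩ := y
  change φ (snocOne _ n s) y ∈ initField k x
  induction hy using IntermediateField.adjoin_induction with
  | mem y hy =>
    obtain ⟨j, rfl⟩ := hy
    rw [hφ, snocOne_castSucc]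
    have h : x j.castSucc ∈ initField k x := IntermediateField.subset_adjoin k _
      (Set.mem_range_self (f := fun j : Fin n => x j.castSucc) j)
    exact mul_mem (algebraMap_mem _ _) (zpow_mem h _)
  | algebraMap a => rw [AlgHom.commutes]; exact algebraMap_mem _ _
  | add y z _ _ hy hz => rw [map_add]; exact add_mem hy hz
  | inv y _ hy => rw [map_inv₀]; exact inv_mem hy
  | mul y z _ _ hy hz => rw [map_mul]; exact mul_mem hy hz

/-- The action of the last factor on `E`, trivial on `k(x_1, …, x_n)`. -/
def lastAction : MonomialEnd k →* (E →ₐ[initField k x] E) where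
  toFun s := { φ (Pi.mulSingle (Fin.last n) s) with
    commutes' := map_mulSingle_last_eq hφ s }
  map_one' := by
    ext a
    change φ (Pi.mulSingle (Fin.last n) 1) a = a
    rw [Pi.mulSingle_one, map_one]
    rfl
  map_mul' s t := by
    ext a
    change φ (Pi.mulSingle (Fin.last n) (s * t)) a = φ _ (φ _ a)
    rw [Pi.mulSingle_mul, map_mul]
    rfl

/-- The action of all but the last factor on `k(x_1, …, x_n)`. -/
def initAction : (Fin n → MonomialEnd k) →* (initField k x →ₐ[k] initField k x) where
  toFun s := ((φ (snocOne _ n s)).comp (initField k x).val).codRestrict (initField k x).toSubalgebra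
    (map_snocOne_mem hφ s)
  map_one' := by
    ext a
    change φ (snocOne _ n 1) a = a
    rw [map_one, map_one]
    rfl
  map_mul' s t := by
    ext a
    change φ (snocOne _ n (s * t)) a = φ _ (φ _ a)
    rw [map_mul, map_mul]
    rfl

theorem coe_initAction (s : Fin n → MonomialEnd k) (y : initField k x) :
    (initAction hφ s y : E) = φ (snocOne _ n s) y := rfl

variable {V : Type*} [AddCommGroup V] [Module E V] (ρ : SemilinearRep φ V)

/-- The restriction of a semi-linear representation to the last factor. -/
def lastRep : SemilinearRep (lastAction hφ) V where
  act := ρ.act.comp (MonoidHom.mulSingle (fun _ : Fin (n + 1) => MonomialEnd k) (Fin.last n))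
  act_smul _ a u := ρ.act_smul _ a u

theorem lastRep_act (s : MonomialEnd k) :
    (lastRep hφ ρ).act s = ρ.act (Pi.mulSingle (Fin.last n) s) := rfl

variable [CharZero k]

/-- The space of vectors on which `x_{n+1} ↦ 2 x_{n+1}` acts unipotently. -/
abbrev unipotentSpace : Submodule (initField k x) V :=
  ((lastRep hφ ρ).toEnd (MonomialEnd.scaling k (unitTwo k))).maxGenEigenspace 1

theorem mem_unipotentSpace {v : V} : v ∈ unipotentSpace hφ ρ ↔
    IsUnipotentAt (ρ.act (Pi.mulSingle (Fin.last n) (MonomialEnd.scaling k (unitTwo k)))) v := by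
  rw [SemilinearRep.mem_maxGenEigenspace_iff, lastRep_act]

theorem act_snocOne_mem (s : Fin n → MonomialEnd k) {v : V} (hv : v ∈ unipotentSpace hφ ρ) :
    ρ.act (snocOne _ n s) v ∈ unipotentSpace hφ ρ := by
  rw [mem_unipotentSpace] at hv ⊢
  exact hv.map_of_commute ((commute_snocOne s _).map ρ.act)

/-- The action of all but the last factor on `unipotentSpace`. -/
def initRep : SemilinearRep (initAction hφ) (unipotentSpace hφ ρ) where
  act :=
    { toFun s :=
        { toFun v := ⟨ρ.act (snocOne _ n s) v, act_snocOne_mem hφ ρ s v.2⟩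
          map_zero' := Subtype.ext (map_zero _)
          map_add' v w := Subtype.ext (map_add _ _ _) }
      map_one' := by
        ext v
        change ρ.act (snocOne _ n 1) v = v
        rw [map_one, map_one]
        rfl
      map_mul' s t := by
        ext v
        change ρ.act (snocOne _ n (s * t)) v = ρ.act _ (ρ.act _ v)
        rw [map_mul, map_mul]
        rfl }
  act_smul _ a v := Subtype.ext (ρ.act_smul _ (a : E) v)

theorem coe_initRep_sub_one_pow (s : Fin n → MonomialEnd k) (i : ℕ) (v : unipotentSpace hφ ρ) :
    ((((initRep hφ ρ).act s - 1) ^ i) v : V) = ((ρ.act (snocOne _ n s) - 1) ^ i) v := by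
  induction i with
  | zero => rfl
  | succ i ih =>
    rw [pow_succ', pow_succ']
    change (((initRep hφ ρ).act s - 1) ((((initRep hφ ρ).act s - 1) ^ i) v) : V) =
      (ρ.act (snocOne _ n s) - 1) (((ρ.act (snocOne _ n s) - 1) ^ i) v)
    rw [← ih]
    rfl

theorem isUnipotentAt_initRep (s : Fin n → MonomialEnd k) (v : unipotentSpace hφ ρ) :
    IsUnipotentAt ((initRep hφ ρ).act s) v ↔ IsUnipotentAt (ρ.act (snocOne _ n s)) (v : V) := by
  simp only [IsUnipotentAt, ← coe_initRep_sub_one_pow hφ ρ, ZeroMemClass.coe_eq_zero]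

variable [FiniteDimensional E V] {l : ℕ} (hl : 2 ≤ l)
  (hroots : ∀ m : ℕ, ∃ ζ : k, IsPrimitiveRoot ζ (l ^ m))
  (hx : AlgebraicIndependent k x) (hgen : IntermediateField.adjoin k (Set.range x) = ⊤)
  {ρ} (hρ : ρ.NonDegenerate)
include hl hroots hx hgen hρ

/-- A basis of `unipotentSpace` over `k(x_1, …, x_n)` is a basis of `V`. -/
theorem exists_basis_of_basis_unipotentSpace {ι : Type*}
    (b : Basis ι (initField k x) (unipotentSpace hφ ρ)) :
    ∃ b' : Basis ι E V, ∀ i, b' i = b i := by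
  have hx' := isRatGenerator_last hx hgen
  have hlast : ∀ s, lastAction hφ s (x (Fin.last n)) =
      algebraMap k E s.coef * x (Fin.last n) ^ (s.expo : ℤ) := by
    intro s
    change φ (Pi.mulSingle (Fin.last n) s) _ = _
    rw [hφ, Pi.mulSingle_eq_same]
  have hli : LinearIndependent E fun i => (b i : V) :=
    hx'.linearIndependent_of_rep hlast (lastRep hφ ρ) (fun i => (b i).2)
      (b.linearIndependent.map' (unipotentSpace hφ ρ).subtype (Submodule.ker_subtype _))
  have hspan := hx'.span_eq_top_of_rep hl hroots hlast (lastRep hφ ρ) fun σ => hρ _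
  refine ⟨Basis.mk hli ?_, fun i => Basis.mk_apply _ _ i⟩
  rw [← hspan, Submodule.span_le]
  intro v hv
  have hv' : (⟨v, hv⟩ : unipotentSpace hφ ρ) ∈ Submodule.span (initField k x) (Set.range b) := by
    rw [b.span_eq]
    trivial
  have h1 := Submodule.mem_map_of_mem (f := (unipotentSpace hφ ρ).subtype) hv'
  rw [Submodule.map_span, ← Set.range_comp] at h1
  exact Submodule.span_le_restrictScalars (initField k x) E _ h1

theorem finite_unipotentSpace : FiniteDimensional (initField k x) (unipotentSpace hφ ρ) := by
  let b := Basis.ofVectorSpace (initField k x) (unipotentSpace hφ ρ)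
  obtain ⟨b', -⟩ := exists_basis_of_basis_unipotentSpace hφ hl hroots hx hgen hρ b
  have := Module.Finite.finite_basis b'
  exact Module.Finite.of_basis b

theorem nonDegenerate_initRep : (initRep hφ ρ).NonDegenerate := by
  intro σ
  have := finite_unipotentSpace hφ hl hroots hx hgen hρ
  let b := Module.finBasis (initField k x) (unipotentSpace hφ ρ)
  obtain ⟨b', hb'⟩ := exists_basis_of_basis_unipotentSpace hφ hl hroots hx hgen hρ b
  have h1 := (hρ.linearIndependent (snocOne _ n σ) b').restrict_scalars' (initField k x)
  have h2 : LinearIndependent (initField k x) fun i => (initRep hφ ρ).act σ (b i) := by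
    apply LinearIndependent.of_comp (unipotentSpace hφ ρ).subtype
    simp only [hb'] at h1
    exact h1
  rw [eq_top_iff, ← h2.span_eq_top_of_card_eq_finrank' (by simp)]
  refine Submodule.span_mono ?_
  rintro _ ⟨i, rfl⟩
  exact ⟨_, rfl⟩

end Field

/-- A non-degenerate semi-linear representation of `(ℤ_{≠0} ⋉ kˣ)^n` has a basis over
`E = k(x_1, …, x_n)` which is a basis over `k` of the space of vectors on which all the
endomorphisms `x_j ↦ 2 x_j` act unipotently. -/
theorem exists_unipotent_basis {k : Type u} [Field k] [CharZero k] {l : ℕ} (hl : 2 ≤ l)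
    (hroots : ∀ m : ℕ, ∃ ζ : k, IsPrimitiveRoot ζ (l ^ m)) (n : ℕ) :
    ∀ {E : Type u} [Field E] [Algebra k E] {x : Fin n → E} (_ : AlgebraicIndependent k x)
      (_ : IntermediateField.adjoin k (Set.range x) = ⊤)
      {φ : (Fin n → MonomialEnd k) →* (E →ₐ[k] E)}
      (_ : ∀ s j, φ s (x j) = algebraMap k E (s j).coef * x j ^ ((s j).expo : ℤ))
      {V : Type v} [AddCommGroup V] [Module E V] [FiniteDimensional E V]
      {ρ : SemilinearRep φ V} (_ : ρ.NonDegenerate),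
      ∃ (N : ℕ) (b : Basis (Fin N) E V), ∀ v,
        (∀ j, IsUnipotentAt (ρ.act (Pi.mulSingle j (MonomialEnd.scaling k (unitTwo k)))) v) ↔
          ∃ a : Fin N → k, v = ∑ i, algebraMap k E (a i) • b i := by
  induction n with
  | zero =>
    intro E _ _ x _ hgen φ _ V _ _ _ ρ _
    refine ⟨_, Module.finBasis E V, fun v => ⟨fun _ => ?_, fun _ j => j.elim0⟩⟩
    have hsurj : ∀ a : E, ∃ c : k, algebraMap k E c = a := by
      intro a
      have : a ∈ IntermediateField.adjoin k (Set.range x) := by rw [hgen]; trivial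
      rw [Set.range_eq_empty, IntermediateField.adjoin_empty] at this
      exact IntermediateField.mem_bot.mp this
    choose f hf using hsurj
    refine ⟨fun i => f ((Module.finBasis E V).repr v i), ?_⟩
    simp only [hf]
    exact ((Module.finBasis E V).sum_repr v).symm
  | succ n ih =>
    intro E _ _ x hx hgen φ hφ V _ _ _ ρ hρ
    have := finite_unipotentSpace hφ hl hroots hx hgen hρ
    let x' : Fin n → initField k x := fun j =>
      ⟨x j.castSucc, IntermediateField.subset_adjoin k _ ⟨j, rfl⟩⟩
    have hx' : AlgebraicIndependent k x' := by
      have h1 : AlgebraicIndependent k ((initField k x).val ∘ x') :=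
        hx.comp _ (Fin.castSucc_injective n)
      exact AlgebraicIndependent.of_comp (initField k x).val h1
    have hgen' : IntermediateField.adjoin k (Set.range x') = ⊤ := by
      rw [eq_top_iff]
      rintro ⟨y, hy⟩ -
      induction hy using IntermediateField.adjoin_induction with
      | mem y hy =>
        obtain ⟨j, rfl⟩ := hy
        exact IntermediateField.subset_adjoin k _ ⟨j, rfl⟩
      | algebraMap a => exact algebraMap_mem _ a
      | add y z _ _ hy hz => exact add_mem hy hz
      | inv y _ hy => exact inv_mem hy
      | mul y z _ _ hy hz => exact mul_mem hy hz
    obtain ⟨N, b, hb⟩ := ih hx' hgen' (φ := initAction hφ) (by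
      intro s j
      apply Subtype.ext
      rw [coe_initAction]
      change φ _ (x j.castSucc) = algebraMap k E (s j).coef * (((x' j) ^ ((s j).expo : ℤ) :
        initField k x) : E)
      rw [hφ, snocOne_castSucc]
      exact congrArg _ (map_zpow₀ (initField k x).val (x' j) _).symm)
      (nonDegenerate_initRep hφ hl hroots hx hgen hρ)
    obtain ⟨b', hb'⟩ := exists_basis_of_basis_unipotentSpace hφ hl hroots hx hgen hρ b
    refine ⟨N, b', fun v => ?_⟩
    simp only [isUnipotentAt_initRep, snocOne_mulSingle] at hb
    constructor
    · intro hv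
      obtain ⟨a, ha⟩ := (hb ⟨v, (mem_unipotentSpace hφ ρ).mpr (hv _)⟩).mp fun j => hv _
      refine ⟨a, ?_⟩
      have h1 := congrArg Subtype.val ha
      simp only [Submodule.coe_sum, Submodule.coe_smul, ← hb'] at h1
      exact h1
    · rintro ⟨a, rfl⟩
      have h1 : (∑ i, algebraMap k E (a i) • b' i) =
          ((∑ i, algebraMap k (initField k x) (a i) • b i : unipotentSpace hφ ρ) : V) := by
        simp only [Submodule.coe_sum, Submodule.coe_smul, ← hb']
        rfl
      rw [h1]
      refine Fin.lastCases ((mem_unipotentSpace hφ ρ).mp (Subtype.property _)) fun j => ?_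
      exact (hb _).mpr ⟨a, rfl⟩ j

end Descent

/-! ### Stability of the unipotent vectors, and representations attached to cocycles -/

section Stability

open Module

theorem IsUnipotentAt.of_sub_one_eq {V : Type*} [AddCommGroup V] {A B S : AddMonoid.End V}
    (hB : B - 1 = S * (A - 1)) (hS : Commute S (A - 1)) {v : V} (hv : IsUnipotentAt A v) :
    IsUnipotentAt B v := by
  obtain ⟨i, hi⟩ := hv
  refine ⟨i, ?_⟩
  rw [hB, hS.mul_pow]
  change (S ^ i) (((A - 1) ^ i) v) = 0
  rw [hi, map_zero]

theorem IsUnipotentAt.zpow {V : Type*} [AddCommGroup V] (A : (AddMonoid.End V)ˣ) {v : V}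
    (hv : IsUnipotentAt (A : AddMonoid.End V) v) (q : ℤ) :
    IsUnipotentAt ((A ^ q : (AddMonoid.End V)ˣ) : AddMonoid.End V) v := by
  have hnat : ∀ n : ℕ, IsUnipotentAt ((A ^ n : (AddMonoid.End V)ˣ) : AddMonoid.End V) v := by
    intro n
    refine hv.of_sub_one_eq (S := ∑ i ∈ Finset.range n, (A : AddMonoid.End V) ^ i) ?_ ?_
    · rw [geom_sum_mul, Units.val_pow_eq_pow_val]
    · refine Commute.sum_left _ _ _ fun i _ => ?_
      exact ((Commute.refl _).sub_right (Commute.one_right _)).pow_left i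
  obtain ⟨n, rfl | rfl⟩ := q.eq_nat_or_neg
  · simpa using hnat n
  · refine (hnat n).of_sub_one_eq (S := -(((A ^ n)⁻¹ : (AddMonoid.End V)ˣ) : AddMonoid.End V))
      ?_ ?_
    · rw [zpow_neg, zpow_natCast, mul_sub, neg_mul, Units.inv_mul]
      simp only [mul_one]
      abel
    · refine (Commute.neg_left ?_).sub_right (Commute.one_right _)
      exact (Commute.refl (A ^ n)).units_val.units_inv_left

variable {k : Type*} [Field k] {F : Type*} [Field F] [Algebra k F] {n : ℕ}
  {φ : (Fin n → MonomialEnd k) →* (F →ₐ[k] F)} {V : Type*} [AddCommGroup V] [Module F V]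

/-- The unipotent vectors for a scaling of one variable are stable under all monomial
endomorphisms. -/
theorem SemilinearRep.isUnipotentAt_act (ρ : SemilinearRep φ V) (j : Fin n) (c : kˣ)
    (σ : Fin n → MonomialEnd k) {v : V}
    (hv : IsUnipotentAt (ρ.act (Pi.mulSingle j (MonomialEnd.scaling k c))) v) :
    IsUnipotentAt (ρ.act (Pi.mulSingle j (MonomialEnd.scaling k c))) (ρ.act σ v) := by
  let A : kˣ →* (AddMonoid.End V)ˣ := ((ρ.act.comp
    (MonoidHom.mulSingle (fun _ : Fin n => MonomialEnd k) j)).comp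
      (MonomialEnd.scaling k)).toHomUnits
  have hA : ∀ d, (A d : AddMonoid.End V) = ρ.act (Pi.mulSingle j (MonomialEnd.scaling k d)) :=
    fun d => rfl
  obtain ⟨i, hi⟩ : IsUnipotentAt (A (c ^ ((σ j).expo : ℤ)) : AddMonoid.End V) v := by
    rw [map_zpow]
    exact IsUnipotentAt.zpow _ hv _
  have hcomm : Pi.mulSingle j (MonomialEnd.scaling k c) * σ =
      σ * Pi.mulSingle j (MonomialEnd.scaling k (c ^ ((σ j).expo : ℤ))) := by
    ext1 i
    by_cases hij : i = j
    · subst hij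
      simp only [Pi.mul_apply, Pi.mulSingle_eq_same, MonomialEnd.scaling_mul]
    · simp [Pi.mulSingle_eq_of_ne hij]
  have h1 : ∀ i, (ρ.act (Pi.mulSingle j (MonomialEnd.scaling k c)) - 1) ^ i * ρ.act σ =
      ρ.act σ * ((A (c ^ ((σ j).expo : ℤ)) : AddMonoid.End V) - 1) ^ i := by
    intro i
    have h2 : SemiconjBy (ρ.act σ) ((A (c ^ ((σ j).expo : ℤ)) : AddMonoid.End V) - 1)
        (ρ.act (Pi.mulSingle j (MonomialEnd.scaling k c)) - 1) := by
      refine SemiconjBy.sub_right ?_ (SemiconjBy.one_right _)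
      rw [hA, SemiconjBy, ← map_mul, ← map_mul, hcomm]
    exact (h2.pow_right i).eq.symm
  refine ⟨i, ?_⟩
  have h3 := DFunLike.congr_fun (h1 i) v
  change ((ρ.act _ - 1) ^ i) (ρ.act σ v) = ρ.act σ (((A _ : AddMonoid.End V) - 1) ^ i • v) at h3
  rw [h3]
  change ρ.act σ ((((A _ : AddMonoid.End V) - 1) ^ i) v) = 0
  rw [hi, map_zero]

end Stability

section Cocycles

variable {k F G : Type*} [Field k] [Field F] [Algebra k F] [Monoid G] {φ : G →* (F →ₐ[k] F)}
  {N : ℕ}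

theorem Cocycle.val_one (f : Cocycle φ N) : f.val 1 = 1 := by
  have h := f.map_mul 1 1
  have h1 : glAct φ N 1 (f.val 1) = f.val 1 := by
    ext i j
    simp [glAct]
  rw [mul_one, h1] at h
  simpa using h

/-- The semi-linear representation on `F ^ N` attached to a cocycle. -/
def Cocycle.rep (f : Cocycle φ N) : SemilinearRep φ (Fin N → F) where
  act :=
    { toFun σ :=
        { toFun v := (f.val σ : Matrix (Fin N) (Fin N) F).mulVec (φ σ ∘ v)
          map_zero' := by
            have : φ σ ∘ (0 : Fin N → F) = 0 := by ext; simp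
            rw [this, Matrix.mulVec_zero]
          map_add' v w := by
            have : φ σ ∘ (v + w) = φ σ ∘ v + φ σ ∘ w := by ext; simp
            rw [this, Matrix.mulVec_add] }
      map_one' := by
        ext v i
        change (f.val 1 : Matrix (Fin N) (Fin N) F).mulVec (φ 1 ∘ v) i = v i
        rw [f.val_one, map_one, Units.val_one, Matrix.one_mulVec]
        rfl
      map_mul' σ τ := by
        ext v : 1
        change (f.val (σ * τ) : Matrix (Fin N) (Fin N) F).mulVec (φ (σ * τ) ∘ v) =
          (f.val σ : Matrix (Fin N) (Fin N) F).mulVec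
            (φ σ ∘ ((f.val τ : Matrix (Fin N) (Fin N) F).mulVec (φ τ ∘ v)))
        have h : φ σ ∘ ((f.val τ : Matrix (Fin N) (Fin N) F).mulVec (φ τ ∘ v)) =
            ((f.val τ : Matrix (Fin N) (Fin N) F).map (φ σ)).mulVec (φ (σ * τ) ∘ v) := by
          ext i
          rw [_root_.map_mul]
          exact RingHom.map_mulVec (φ σ : F →+* F) _ _ i
        rw [h, f.map_mul, Matrix.mulVec_mulVec]
        rfl }
  act_smul σ a v := by
    change (f.val σ : Matrix (Fin N) (Fin N) F).mulVec (φ σ ∘ (a • v)) =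
      φ σ a • (f.val σ : Matrix (Fin N) (Fin N) F).mulVec (φ σ ∘ v)
    rw [← Matrix.mulVec_smul]
    congr 1
    ext i
    simp

theorem Cocycle.rep_act (f : Cocycle φ N) (σ : G) (v : Fin N → F) :
    f.rep.act σ v = (f.val σ : Matrix (Fin N) (Fin N) F).mulVec (φ σ ∘ v) := rfl

theorem Cocycle.rep_act_single (f : Cocycle φ N) (σ : G) (i : Fin N) :
    f.rep.act σ (Pi.single i 1) = (f.val σ : Matrix (Fin N) (Fin N) F).col i := by
  have : φ σ ∘ (Pi.single i 1 : Fin N → F) = Pi.single i 1 := by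
    ext j
    by_cases h : j = i
    · subst h; simp
    · simp [h]
  rw [f.rep_act, this, Matrix.mulVec_single_one]

theorem Cocycle.nonDegenerate_rep (f : Cocycle φ N) : f.rep.NonDegenerate := by
  intro σ
  rw [eq_top_iff]
  intro w _
  let B : Matrix (Fin N) (Fin N) F := ((f.val σ)⁻¹ : GL (Fin N) F)
  have h : w = ∑ i, B.mulVec w i • f.rep.act σ (Pi.single i 1) := by
    simp only [f.rep_act_single]
    have h1 : (f.val σ : Matrix (Fin N) (Fin N) F).mulVec (B.mulVec w) = w := by
      rw [Matrix.mulVec_mulVec, Units.mul_inv, Matrix.one_mulVec]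
    conv_lhs => rw [← h1]
    ext j
    simp [Matrix.mulVec, dotProduct, mul_comm]
  rw [h]
  exact Submodule.sum_mem _ fun i _ => Submodule.smul_mem _ _ (Submodule.subset_span ⟨_, rfl⟩)

end Cocycles

/-! ### Unipotence of constant representations -/

section Constant

open Module

theorem IsUnipotentAt.map_of_intertwines {V V' : Type*} [AddCommGroup V] [AddCommGroup V']
    {A : AddMonoid.End V} {B : AddMonoid.End V'} (β : V →+ V') (h : ∀ v, B (β v) = β (A v)) {v : V}
    (hv : IsUnipotentAt A v) : IsUnipotentAt B (β v) := by
  obtain ⟨i, hi⟩ := hv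
  refine ⟨i, ?_⟩
  have key : ∀ i : ℕ, ((B - 1) ^ i) (β v) = β (((A - 1) ^ i) v) := by
    intro i
    induction i with
    | zero => rfl
    | succ i ih =>
      rw [pow_succ', pow_succ']
      change (B - 1) (((B - 1) ^ i) (β v)) = β ((A - 1) (((A - 1) ^ i) v))
      rw [ih]
      change B _ - β _ = β (A _ - _)
      rw [h, map_sub]
      rfl
  rw [key, hi, map_zero]

/-- An automorphism `T` of a finite-dimensional space which is conjugate to all its powers `T ^ q`,
`q > 0`, is unipotent: its eigenvalues are roots of unity, because the finite set of eigenvalues is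
stable under powers, and a suitable power of `T` has the only eigenvalue `1`. -/
theorem exists_sub_one_pow_eq_zero {k V : Type*} [Field k] [AddCommGroup V] [Module k V]
    [FiniteDimensional k V] {T : Module.End k V} (hT : Function.Injective T)
    (hpow : ∀ q : ℕ, 0 < q → ∃ Θ : Module.End k V,
      (∀ u, T (Θ u) = Θ ((T ^ q) u)) ∧ Function.Bijective Θ) :
    ∃ d : ℕ, (T - 1) ^ d = 0 := by
  classical
  let K := AlgebraicClosure k
  have hint : IsIntegral k T := Algebra.IsIntegral.isIntegral T
  set p := minpoly k T with hp
  have hp0 : p ≠ 0 := minpoly.ne_zero hint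
  have hroots : ∀ μ : K, aeval μ p = 0 → IsSpectral K T μ := by
    intro μ hμ
    obtain ⟨r, hr⟩ := minpoly.dvd k μ hμ
    have hr0 : r ≠ 0 := by
      rintro rfl
      exact hp0 (by rw [hr, mul_zero])
    have hm0 : minpoly k μ ≠ 0 := fun h => hp0 (by rw [hr, h, zero_mul])
    have hrT : aeval T r ≠ 0 := by
      intro h
      have h1 := natDegree_le_of_dvd (minpoly.dvd k T h) hr0
      rw [← hp, hr, natDegree_mul hm0 hr0] at h1
      have := minpoly.natDegree_pos (Algebra.IsIntegral.isIntegral (R := k) μ)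
      omega
    obtain ⟨u, hu⟩ : ∃ u, aeval T r u ≠ 0 := by
      by_contra! h
      exact hrT (LinearMap.ext h)
    exact ⟨_, hu, by rw [← aeval_mul_apply, ← hr, hp, minpoly.aeval, LinearMap.zero_apply]⟩
  have hspec : ∀ μ : K, IsSpectral K T μ → μ ∈ (p.aroots K).toFinset := by
    rintro μ ⟨v, hv0, hv⟩
    have hirr := minpoly.irreducible (Algebra.IsIntegral.isIntegral (R := k) μ)
    obtain ⟨r, hr⟩ := (hirr.isCoprime_or_dvd p).resolve_left fun hco => hv0
      (eq_zero_of_isCoprime T hco hv (by rw [hp, minpoly.aeval, LinearMap.zero_apply]))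
    rw [Multiset.mem_toFinset, mem_aroots]
    exact ⟨hp0, by rw [hr, map_mul, minpoly.aeval, zero_mul]⟩
  have htors : ∀ μ : K, IsSpectral K T μ → ∃ M : ℕ, 0 < M ∧ μ ^ M = 1 := by
    intro μ hμ
    have hμ0 := hμ.ne_zero hT
    have hμi : ∀ i : ℕ, μ ^ (2 ^ i) ∈ (p.aroots K).toFinset := by
      intro i
      obtain ⟨Θ, hΘ, hbij⟩ := hpow (2 ^ i) (by positivity)
      exact hspec _ (hμ.pow hΘ hbij.1)
    obtain ⟨a, b, hab, h⟩ := Finite.exists_ne_map_eq_of_infinite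
      (fun i => (⟨_, hμi i⟩ : {α : K // α ∈ (p.aroots K).toFinset}))
    wlog hlt : a < b generalizing a b
    · exact this b a hab.symm h.symm (lt_of_le_of_ne (not_lt.mp hlt) hab.symm)
    have h' := congrArg Subtype.val h
    simp only at h'
    have hlt2 : 2 ^ a < 2 ^ b := Nat.pow_lt_pow_right (by norm_num) hlt
    refine ⟨2 ^ b - 2 ^ a, Nat.sub_pos_of_lt hlt2, ?_⟩
    apply mul_right_cancel₀ (pow_ne_zero (2 ^ a) hμ0)
    rw [← pow_add, Nat.sub_add_cancel hlt2.le, one_mul, h']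
  obtain ⟨M, hM0, hf⟩ : ∃ M : ℕ, 0 < M ∧ ∀ μ ∈ p.aroots K, μ ^ M = algebraMap k K 1 := by
    have h1 : ∀ μ ∈ p.aroots K, ∃ M : ℕ, 0 < M ∧ μ ^ M = 1 :=
      fun μ hμ => htors μ (hroots μ (by simpa [hp0] using hμ))
    choose! m hm hn using h1
    refine ⟨∏ μ ∈ (p.aroots K).toFinset, m μ,
      Finset.prod_pos fun μ hμ => hm μ (Multiset.mem_toFinset.mp hμ), fun μ hμ => ?_⟩
    rw [← Finset.mul_prod_erase _ _ (Multiset.mem_toFinset.mpr hμ), pow_mul, hn μ hμ, one_pow,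
      map_one]
  obtain ⟨Θ, hΘ, hbij⟩ := hpow M hM0
  refine ⟨(p.aroots K).card, ?_⟩
  ext u
  obtain ⟨w, rfl⟩ := hbij.2 u
  have h1 := aeval_apply_eq_zero_of_dvd T (dvd_expand_prod (K := K) (f := fun _ => 1) hp0 hf)
    (w := w) (by rw [hp, minpoly.aeval, LinearMap.zero_apply])
  have h2 := aeval_apply_of_intertwines hΘ ((p.aroots K).map fun _ => X - C (1 : k)).prod w
  rw [h1, map_zero] at h2
  simpa using h2

variable {k : Type*} [Field k] {N : ℕ}

/-- The linear representation on `k ^ N` attached to a cocycle for the trivial action. -/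
def Cocycle.constRep {G : Type*} [Monoid G] (f : Cocycle (trivialAction G k) N) :
    G →* Module.End k (Fin N → k) where
  toFun σ := Matrix.toLin' (f.val σ : Matrix (Fin N) (Fin N) k)
  map_one' := by
    rw [f.val_one, Units.val_one, Matrix.toLin'_one]
    rfl
  map_mul' σ τ := by
    have h : glAct (trivialAction G k) N σ (f.val τ) = f.val τ := by
      ext i j
      simp [glAct, trivialAction]
    rw [f.map_mul, h, Units.val_mul, Matrix.toLin'_mul]
    rfl

theorem Cocycle.bijective_constRep {G : Type*} [Monoid G] (f : Cocycle (trivialAction G k) N)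
    (σ : G) : Function.Bijective (f.constRep σ) := by
  have h1 : f.constRep σ * Matrix.toLin' ((f.val σ)⁻¹ : GL (Fin N) k).val = 1 := by
    change Matrix.toLin' _ * Matrix.toLin' _ = _
    rw [Module.End.mul_eq_comp, ← Matrix.toLin'_mul, Units.mul_inv, Matrix.toLin'_one]
    rfl
  have h2 : Matrix.toLin' ((f.val σ)⁻¹ : GL (Fin N) k).val * f.constRep σ = 1 := by
    change Matrix.toLin' _ * Matrix.toLin' _ = _
    rw [Module.End.mul_eq_comp, ← Matrix.toLin'_mul, Units.inv_mul, Matrix.toLin'_one]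
    rfl
  refine Function.bijective_iff_has_inverse.mpr
    ⟨Matrix.toLin' ((f.val σ)⁻¹ : GL (Fin N) k).val, fun v => ?_, fun v => ?_⟩
  · exact LinearMap.congr_fun h2 v
  · exact LinearMap.congr_fun h1 v

variable {n : ℕ}

theorem mulSingle_scaling_mul_power (j : Fin n) (c : kˣ) (q : ℕ) (hq : 0 < q) :
    (Pi.mulSingle j (MonomialEnd.scaling k c) : Fin n → MonomialEnd k) *
        Pi.mulSingle j (MonomialEnd.power k q hq) =
      Pi.mulSingle j (MonomialEnd.power k q hq) * Pi.mulSingle j (MonomialEnd.scaling k c) ^ q := by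
  rw [← Pi.mulSingle_mul, MonomialEnd.scaling_mul_power, Pi.mulSingle_mul, Pi.mulSingle_pow]

/-- Scalings of a variable act unipotently in every representation over the constants. -/
theorem Cocycle.exists_constRep_sub_one_pow
    (f : Cocycle (trivialAction (Fin n → MonomialEnd k) k) N) (j : Fin n) (c : kˣ) :
    ∃ d : ℕ, (f.constRep (Pi.mulSingle j (MonomialEnd.scaling k c)) - 1) ^ d = 0 := by
  refine exists_sub_one_pow_eq_zero (f.bijective_constRep _).1 fun q hq =>
    ⟨f.constRep (Pi.mulSingle j (MonomialEnd.power k q hq)), fun u => ?_, f.bijective_constRep _⟩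
  rw [← map_pow, ← Module.End.mul_apply, ← Module.End.mul_apply, ← _root_.map_mul, ← _root_.map_mul,
    mulSingle_scaling_mul_power]

/-- Constant vectors are unipotent for the semi-linear representation attached to a constant
cocycle. -/
theorem Cocycle.isUnipotentAt_extendScalars {F : Type*} [Field F] [Algebra k F]
    (φ : (Fin n → MonomialEnd k) →* (F →ₐ[k] F))
    (f : Cocycle (trivialAction (Fin n → MonomialEnd k) k) N) (j : Fin n) (c : kˣ) (w : Fin N → k) :
    IsUnipotentAt ((f.extendScalars φ).rep.act (Pi.mulSingle j (MonomialEnd.scaling k c)))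
      (algebraMap k F ∘ w) := by
  set σ : Fin n → MonomialEnd k := Pi.mulSingle j (MonomialEnd.scaling k c)
  have h1 : IsUnipotentAt (V := Fin N → k) (f.constRep σ).toAddMonoidHom w := by
    obtain ⟨d, hd⟩ := f.exists_constRep_sub_one_pow j c
    refine ⟨d, ?_⟩
    have : ∀ i, ((show AddMonoid.End (Fin N → k) from (f.constRep σ).toAddMonoidHom) - 1) ^ i =
        ((f.constRep σ - 1) ^ i).toAddMonoidHom := by
      intro i
      induction i with
      | zero => rfl
      | succ i ih =>
        rw [pow_succ', pow_succ', ih]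
        rfl
    have h2 := DFunLike.congr_fun (this d) w
    rw [hd] at h2
    exact h2
  refine h1.map_of_intertwines
    (AddMonoidHom.compLeft (algebraMap k F : k →+ F) (Fin N)) fun v => ?_
  change ((f.extendScalars φ).val σ : Matrix (Fin N) (Fin N) F).mulVec
    (φ σ ∘ (algebraMap k F ∘ v)) = algebraMap k F ∘ (f.constRep σ v)
  have h2 : φ σ ∘ (algebraMap k F ∘ v) = algebraMap k F ∘ v := by
    ext i
    simp
  rw [h2]
  ext i
  exact (RingHom.map_mulVec (algebraMap k F) (f.val σ : Matrix (Fin N) (Fin N) k) v i).symm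

end Constant

/-! ### Semi-linear representations over the field of rational functions -/

section RatFunctionField

open Module

variable {k : Type u} [Field k] {n : ℕ}

theorem algebraicIndependent_ratVar : AlgebraicIndependent k (ratVar k (n := n)) := by
  intro p q hpq
  change MvPolynomial.aeval _ p = MvPolynomial.aeval _ q at hpq
  rw [aeval_ratVar, aeval_ratVar] at hpq
  exact FaithfulSMul.algebraMap_injective _ _ hpq

theorem adjoin_ratVar : IntermediateField.adjoin k (Set.range (ratVar k (n := n))) = ⊤ := by
  have h : ∀ p : MvPolynomial (Fin n) k, algebraMap _ (RatFunctionField k n) p ∈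
      IntermediateField.adjoin k (Set.range (ratVar k (n := n))) := by
    intro p
    rw [← aeval_ratVar]
    refine IntermediateField.algebra_adjoin_le_adjoin k _ ?_
    rw [Algebra.adjoin_range_eq_range_aeval]
    exact ⟨p, rfl⟩
  rw [eq_top_iff]
  intro z _
  obtain ⟨a, b, -, rfl⟩ := IsFractionRing.div_surjective (MvPolynomial (Fin n) k) z
  exact div_mem (h a) (h b)

/-- A semi-linear representation has a basis in which the vectors unipotent for all the scalings
`x_j ↦ 2 x_j` are those with constant coordinates, and the action has constant matrices. -/
theorem exists_constant_basis [CharZero k] {l : ℕ} (hl : 2 ≤ l)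
    (hroots : ∀ m : ℕ, ∃ ζ : k, IsPrimitiveRoot ζ (l ^ m)) {V : Type v} [AddCommGroup V]
    [Module (RatFunctionField k n) V] [FiniteDimensional (RatFunctionField k n) V]
    {ρ : SemilinearRep (monomialAction k n) V} (hρ : ρ.NonDegenerate) :
    ∃ (N : ℕ) (b : Basis (Fin N) (RatFunctionField k n) V)
      (C : (Fin n → MonomialEnd k) →* Matrix (Fin N) (Fin N) k),
      (∀ v, (∀ j, IsUnipotentAt (ρ.act (Pi.mulSingle j (MonomialEnd.scaling k (unitTwo k)))) v) ↔
        ∃ a : Fin N → k, v = ∑ i, algebraMap k (RatFunctionField k n) (a i) • b i) ∧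
      ∀ σ j, ρ.act σ (b j) = ∑ i, algebraMap k (RatFunctionField k n) (C σ i j) • b i := by
  obtain ⟨N, b, hb⟩ := exists_unipotent_basis hl hroots n algebraicIndependent_ratVar
    adjoin_ratVar (φ := monomialAction k n) (fun s j => monomialHom_ratVar s j) hρ
  have h1 : ∀ (σ : Fin n → MonomialEnd k) (j : Fin N), ∃ a : Fin N → k,
      ρ.act σ (b j) = ∑ i, algebraMap k (RatFunctionField k n) (a i) • b i := by
    intro σ j
    refine (hb _).mp fun m => ρ.isUnipotentAt_act m _ σ ((hb _).mpr ⟨Pi.single j 1, ?_⟩ m)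
    simp [Pi.single_apply, apply_ite (algebraMap k (RatFunctionField k n)), ite_smul]
  choose C hC using h1
  have hrepr : ∀ σ i j, algebraMap k (RatFunctionField k n) (C σ j i) =
      b.repr (ρ.act σ (b j)) i := by
    intro σ i j
    rw [hC, b.repr_sum_self]
  refine ⟨N, b, ⟨⟨fun σ => Matrix.of fun i j => C σ j i, ?_⟩, fun σ τ => ?_⟩, hb, hC⟩
  · ext i j
    apply FaithfulSMul.algebraMap_injective k (RatFunctionField k n)
    rw [Matrix.of_apply, hrepr, ρ.act_one_apply, b.repr_self, Finsupp.single_apply,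
      Matrix.one_apply]
    simp [eq_comm]
  · ext i j
    apply FaithfulSMul.algebraMap_injective k (RatFunctionField k n)
    change algebraMap k (RatFunctionField k n) (C (σ * τ) j i) =
      algebraMap k (RatFunctionField k n) (∑ m, C σ m i * C τ j m)
    rw [hrepr, ρ.act_mul_apply, hC τ j, map_sum, map_sum, Finsupp.finsetSum_apply, map_sum]
    refine Finset.sum_congr rfl fun m _ => ?_
    rw [ρ.act_smul, AlgHom.commutes, map_smul, Finsupp.smul_apply, ← hrepr, smul_eq_mul, map_mul,
      mul_comm]

/-- A semi-linear representation which acts by constant matrices in some basis is induced. -/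
theorem SemilinearRep.isInduced_of_basis {F : Type*} [Field F] [Algebra k F] {G : Type w}
    [Monoid G] {φ : G →* (F →ₐ[k] F)} {V : Type*} [AddCommGroup V] [Module F V]
    {ρ : SemilinearRep φ V} {N : ℕ} (b : Basis (Fin N) F V) (C : G →* Matrix (Fin N) (Fin N) k)
    (hC : ∀ σ j, ρ.act σ (b j) = ∑ i, algebraMap k F (C σ i j) • b i) : ρ.IsInduced := by
  let e : (F ⊗[k] (Fin N → k)) ≃ₗ[F] V :=
    (Algebra.TensorProduct.basis F (Pi.basisFun k (Fin N))).equiv b (Equiv.refl _)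
  have he : ∀ (a : F) (x : Fin N → k), e (a ⊗ₜ[k] x) = ∑ i, (a * algebraMap k F (x i)) • b i := by
    intro a x
    have h : a ⊗ₜ[k] x = ∑ i, (a * algebraMap k F (x i)) •
        Algebra.TensorProduct.basis F (Pi.basisFun k (Fin N)) i := by
      conv_lhs => rw [← (Pi.basisFun k (Fin N)).sum_repr x, TensorProduct.tmul_sum]
      refine Finset.sum_congr rfl fun i _ => ?_
      rw [Algebra.TensorProduct.basis_apply, TensorProduct.smul_tmul', smul_eq_mul, mul_one,
        TensorProduct.tmul_smul, TensorProduct.smul_tmul', Algebra.smul_def, mul_comm]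
      rfl
    rw [h, map_sum]
    refine Finset.sum_congr rfl fun i _ => ?_
    rw [map_smul, Basis.equiv_apply]
    rfl
  refine ⟨Fin N → k, inferInstance, inferInstance,
    (Matrix.toLinAlgEquiv' : _ ≃ₐ[k] Module.End k (Fin N → k)).toMonoidHom.comp C, e,
    fun σ a x => ?_⟩
  rw [he, he, map_sum]
  simp only [ρ.act_smul, hC, Finset.smul_sum, smul_smul, map_mul, AlgHom.commutes]
  rw [Finset.sum_comm]
  refine Finset.sum_congr rfl fun i _ => ?_
  rw [← Finset.sum_smul]
  congr 1
  change _ = φ σ a * algebraMap k F ((C σ).mulVec x i)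
  rw [Matrix.mulVec, dotProduct, map_sum, Finset.mul_sum]
  refine Finset.sum_congr rfl fun j _ => ?_
  rw [map_mul, mul_assoc, mul_comm (algebraMap k F (x j))]

end RatFunctionField

/-! ### Comparison of the cohomology sets -/

section Comparison

open Module

variable {k : Type u} [Field k] {n N : ℕ}

theorem Matrix.GeneralLinearGroup.map_algebraMap_injective (F : Type*) [Field F] [Algebra k F] :
    Function.Injective (Matrix.GeneralLinearGroup.map (n := Fin N) (algebraMap k F)) := by
  intro A B h
  ext i j
  apply FaithfulSMul.algebraMap_injective k F
  exact congrArg (fun D : GL (Fin N) F => D i j) h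

theorem glAct_trivialAction {G : Type*} [Monoid G] (σ : G) (A : GL (Fin N) k) :
    glAct (trivialAction G k) N σ A = A := by
  ext i j
  simp [glAct, trivialAction]

theorem glAct_map_algebraMap {F G : Type*} [Field F] [Algebra k F] [Monoid G]
    (φ : G →* (F →ₐ[k] F)) (σ : G) (A : GL (Fin N) k) :
    glAct φ N σ (Matrix.GeneralLinearGroup.map (algebraMap k F) A) =
      Matrix.GeneralLinearGroup.map (algebraMap k F) A := by
  ext i j
  simp [glAct]

/-- An invertible matrix over `F` with entries in `k` is invertible over `k`. -/
theorem exists_map_algebraMap_eq {F : Type*} [Field F] [Algebra k F] (A : GL (Fin N) F)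
    (B : Matrix (Fin N) (Fin N) k) (h : (A : Matrix (Fin N) (Fin N) F) = B.map (algebraMap k F)) :
    ∃ B' : GL (Fin N) k, (B' : Matrix (Fin N) (Fin N) k) = B ∧
      Matrix.GeneralLinearGroup.map (algebraMap k F) B' = A := by
  have hdet : B.det ≠ 0 := by
    intro h0
    have h1 := A.det_ne_zero
    rw [h, ← RingHom.mapMatrix_apply, ← RingHom.map_det, h0, map_zero] at h1
    exact h1 rfl
  refine ⟨Matrix.GeneralLinearGroup.mkOfDetNeZero B hdet, rfl, ?_⟩
  ext i j
  rw [h]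
  rfl

/-- Every cocycle over the rational functions is cohomologous to a constant one. -/
theorem surjective_extendScalars [CharZero k] {l : ℕ} (hl : 2 ≤ l)
    (hroots : ∀ m : ℕ, ∃ ζ : k, IsPrimitiveRoot ζ (l ^ m)) :
    Function.Surjective (H1.extendScalars (monomialAction k n) N) := by
  intro y
  obtain ⟨f, rfl⟩ := Quotient.exists_rep y
  obtain ⟨N', b, C, -, hC⟩ := exists_constant_basis hl hroots f.nonDegenerate_rep
  obtain rfl : N' = N := by
    have h := Module.finrank_eq_card_basis b
    simpa using h.symm
  -- the matrix of the basis `b`, in which the action is constant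
  let P : GL (Fin N') (RatFunctionField k n) := Matrix.GeneralLinearGroup.mkOfDetNeZero
    (Matrix.of fun i j => b j i) (by
      have h : IsUnit (Matrix.of fun i j => b j i) :=
        Matrix.linearIndependent_cols_iff_isUnit.mp b.linearIndependent
      exact ((Matrix.isUnit_iff_isUnit_det _).mp h).ne_zero)
  have hP : ∀ σ, ((P⁻¹ * f.val σ * glAct (monomialAction k n) N' σ P :
      GL (Fin N') (RatFunctionField k n)) : Matrix (Fin N') (Fin N') (RatFunctionField k n)) =
      (C σ).map (algebraMap k (RatFunctionField k n)) := by
    intro σ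
    rw [mul_assoc, Units.val_mul, Units.inv_mul_eq_iff_eq_mul]
    ext i j
    have h := congrFun (hC σ j) i
    rw [f.rep_act, Finset.sum_apply] at h
    refine h.trans ?_
    rw [Matrix.mul_apply]
    exact Finset.sum_congr rfl fun m _ => mul_comm _ _
  choose g hgC hg using fun σ => exists_map_algebraMap_eq _ _ (hP σ)
  refine ⟨Quotient.mk _ ⟨g, fun σ τ => ?_⟩, Quotient.sound ⟨P, hg⟩⟩
  rw [glAct_trivialAction]
  ext1
  rw [Units.val_mul, hgC, hgC, hgC, map_mul]

/-- Vectors which are unipotent for all scalings `x_j ↦ 2 x_j`, with respect to a constant cocycle,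
are constant: the constant vectors are unipotent, and both the constant vectors and the unipotent
ones are `k`-forms of the representation. -/
theorem Cocycle.exists_eq_algebraMap_of_isUnipotentAt [CharZero k] {l : ℕ} (hl : 2 ≤ l)
    (hroots : ∀ m : ℕ, ∃ ζ : k, IsPrimitiveRoot ζ (l ^ m))
    (g : Cocycle (trivialAction (Fin n → MonomialEnd k) k) N) {v : Fin N → RatFunctionField k n}
    (hv : ∀ j, IsUnipotentAt ((g.extendScalars (monomialAction k n)).rep.act
      (Pi.mulSingle j (MonomialEnd.scaling k (unitTwo k)))) v) :
    ∃ w : Fin N → k, v = algebraMap k (RatFunctionField k n) ∘ w := by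
  obtain ⟨N', b, -, hb, -⟩ := exists_constant_basis hl hroots
    (g.extendScalars (monomialAction k n)).nonDegenerate_rep
  obtain rfl : N' = N := by
    have h := Module.finrank_eq_card_basis b
    simpa using h.symm
  have h1 : ∀ i : Fin N', ∃ a : Fin N' → k,
      algebraMap k (RatFunctionField k n) ∘ (Pi.single i 1 : Fin N' → k) =
        ∑ m, algebraMap k (RatFunctionField k n) (a m) • b m := fun i =>
    (hb _).mp fun j => g.isUnipotentAt_extendScalars _ j _ _
  choose A hA using h1
  -- the unit vectors are constant, hence unipotent: the base change `A'` to the basis `b` of the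
  -- unipotent vectors is constant, and so is its inverse `B`
  let B : Matrix (Fin N') (Fin N') (RatFunctionField k n) := Matrix.of fun i j => b j i
  let A' : Matrix (Fin N') (Fin N') k := Matrix.of fun m i => A i m
  have hBA : B * A'.map (algebraMap k (RatFunctionField k n)) = 1 := by
    ext i j
    have h := congrFun (hA j) i
    rw [Finset.sum_apply] at h
    rw [Matrix.mul_apply, Matrix.one_apply]
    refine (Finset.sum_congr rfl fun m _ => mul_comm _ _).trans (h.symm.trans ?_)
    simp [Pi.single_apply, apply_ite (algebraMap k (RatFunctionField k n))]
  have hdet : A'.det ≠ 0 := by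
    intro h0
    have h2 := congrArg Matrix.det hBA
    rw [Matrix.det_mul, ← RingHom.mapMatrix_apply, ← RingHom.map_det, h0, map_zero, mul_zero,
      Matrix.det_one] at h2
    exact zero_ne_one h2
  have hB : B = A'⁻¹.map (algebraMap k (RatFunctionField k n)) := by
    have h3 : A'.map (algebraMap k (RatFunctionField k n)) *
        A'⁻¹.map (algebraMap k (RatFunctionField k n)) = 1 := by
      rw [← Matrix.map_mul, Matrix.mul_nonsing_inv _ (isUnit_iff_ne_zero.mpr hdet)]
      simp
    calc B = B * (A'.map (algebraMap k (RatFunctionField k n)) *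
        A'⁻¹.map (algebraMap k (RatFunctionField k n))) := by rw [h3, mul_one]
      _ = _ := by rw [← mul_assoc, hBA, one_mul]
  obtain ⟨a, ha⟩ := (hb v).mp hv
  refine ⟨A'⁻¹.mulVec a, ?_⟩
  ext i
  rw [ha, Finset.sum_apply, Function.comp_apply, RingHom.map_mulVec]
  change _ = (A'⁻¹.map (algebraMap k (RatFunctionField k n))).mulVec _ i
  rw [← hB]
  exact Finset.sum_congr rfl fun m _ => mul_comm _ _

/-- Constant cocycles which are cohomologous over the rational functions are cohomologous over the
constants: an isomorphism of the representations respects unipotent vectors, so its matrix is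
constant. -/
theorem injective_extendScalars [CharZero k] {l : ℕ} (hl : 2 ≤ l)
    (hroots : ∀ m : ℕ, ∃ ζ : k, IsPrimitiveRoot ζ (l ^ m)) :
    Function.Injective (H1.extendScalars (monomialAction k n) N) := by
  intro y z hyz
  obtain ⟨f, rfl⟩ := Quotient.exists_rep y
  obtain ⟨g, rfl⟩ := Quotient.exists_rep z
  obtain ⟨b, hb⟩ := Quotient.exact hyz
  have hcol : ∀ i, ∃ w : Fin N → k, (b : Matrix (Fin N) (Fin N) (RatFunctionField k n)).col i =
      algebraMap k (RatFunctionField k n) ∘ w := by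
    intro i
    refine g.exists_eq_algebraMap_of_isUnipotentAt hl hroots fun j => ?_
    have h := (f.isUnipotentAt_extendScalars (monomialAction k n) j (unitTwo k)
      (Pi.single i 1)).map_of_intertwines
      (B := (g.extendScalars (monomialAction k n)).rep.act
        (Pi.mulSingle j (MonomialEnd.scaling k (unitTwo k))))
      (Matrix.mulVecLin (b : Matrix (Fin N) (Fin N) (RatFunctionField k n))).toAddMonoidHom
      (fun v => by
        set σ : Fin n → MonomialEnd k := Pi.mulSingle j (MonomialEnd.scaling k (unitTwo k))
        have h1 : b * (f.extendScalars (monomialAction k n)).val σ =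
            (g.extendScalars (monomialAction k n)).val σ * glAct (monomialAction k n) N σ b := by
          rw [hb σ]
          group
        have h2 := congrArg Units.val h1
        rw [Units.val_mul, Units.val_mul] at h2
        change Matrix.mulVec _ (monomialAction k n σ ∘
            (b : Matrix (Fin N) (Fin N) (RatFunctionField k n)).mulVec v) =
          (b : Matrix (Fin N) (Fin N) (RatFunctionField k n)).mulVec
            (Matrix.mulVec _ (monomialAction k n σ ∘ v))
        rw [Matrix.mulVec_mulVec, h2, ← Matrix.mulVec_mulVec]
        congr 1
        ext i
        exact RingHom.map_mulVec
          (monomialAction k n σ : RatFunctionField k n →+* RatFunctionField k n) _ _ i)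
    have h3 : (algebraMap k (RatFunctionField k n)) ∘ (Pi.single i 1 : Fin N → k) =
        Pi.single i 1 := by
      ext m
      simp [Pi.single_apply, apply_ite (algebraMap k (RatFunctionField k n))]
    rw [h3] at h
    change IsUnipotentAt _ (Matrix.mulVec _ (Pi.single i 1)) at h
    rwa [Matrix.mulVec_single_one] at h
  choose w hw using hcol
  obtain ⟨b', -, rfl⟩ := exists_map_algebraMap_eq b (Matrix.of fun i j => w j i) (by
    ext i j
    exact congrFun (hw j) i)
  refine Quotient.sound ⟨b', fun σ => ?_⟩
  apply Matrix.GeneralLinearGroup.map_algebraMap_injective (RatFunctionField k n)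
  have h := hb σ
  rw [glAct_map_algebraMap] at h
  rw [glAct_trivialAction, map_mul, map_mul, map_inv]
  exact h

end Comparison

theorem mainTheorem3 (k : Type u) [Field k] [CharZero k] (l : ℕ) (hl : 2 ≤ l)
    (hroots : ∀ m : ℕ, ∃ ζ : k, IsPrimitiveRoot ζ (l ^ m)) (n N : ℕ) :
    Function.Bijective (H1.extendScalars (monomialAction k n) N) ∧
    ∀ (V : Type v) [AddCommGroup V] [Module (RatFunctionField k n) V]
      [FiniteDimensional (RatFunctionField k n) V] (ρ : SemilinearRep (monomialAction k n) V),
      ρ.NonDegenerate → ρ.IsInduced := by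
  refine ⟨⟨injective_extendScalars hl hroots, surjective_extendScalars hl hroots⟩, ?_⟩
  intro V _ _ _ ρ hρ
  obtain ⟨N', b, C, -, hC⟩ := exists_constant_basis hl hroots hρ
  exact SemilinearRep.isInduced_of_basis b C hC
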